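/- Let $S\ge 2$ and let $\eta,\zeta$ be nonzero real numbers with $\eta^2+\zeta^2=1$. An unknown state $\rho$ of $S$ bosonic modes $a_1,\dots,a_S$ and a probe in $S$ modes $b_1,\dots,b_S$, prepared in the coherent state $|\gamma,0,\dots,0\rangle$, are sent through a beam splitter that acts identically on all modes: $a_i\mapsto \eta a_i+\zeta b_i$, $b_i\mapsto \zeta a_i-\eta b_i$. Each of the two output paths ends in a click detector that does not distinguish the modes: it clicks if and only if there is at least one photon in some mode of its path. The measurement statistics of $\rho$ are the probabilities of the four joint outcomes (click or no click at each detector), for all probe amplitudes $\gamma\in\mathbb C$. The two-mode twirled state of $\rho$ is $\tilde\rho_2=\sum_n \chi_n\otimes|n\rangle\langle n|$, where $\chi_n=\operatorname{tr}_{2,\dots,S}\big((I\otimes P_n)\,\bar\rho\big)$, $\bar\rho$ is the Haar average of $\rho$ over the passive linear-optics unitaries $U(S-1)$ of the modes $a_2,\dots,a_S$, and $P_n$ is the projection onto total photon number $n$ in these modes. The beam splitter is called balanced if $|\eta|=|\zeta|=1/\sqrt2$, and unbalanced otherwise. Let $N\ge 0$ be an integer. Say that $\tilde\rho_2$ is determined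 if any two states $\rho,\sigma$ with at most $N$ photons that have the same measurement statistics also have the same two-mode twirled state. Then, for an unbalanced beam splitter, $\tilde\rho_2$ is determined if and only if $N\le 2$; for a balanced beam splitter, $\tilde\rho_2$ is determined if and only if $N\le 1$. -/

import Mathlib

open scoped Nat BigOperators ComplexOrder

noncomputable section

namespace WFH

/-! ### Fock space of finitely many bosonic modes

A Fock basis vector of the modes `ι` is an occupation number function `n : ι → ℕ`; an operator is
given by its matrix in the Fock basis. -/

section Fock

variable {ι : Type*} [Fintype ι]

/-- The matrix `⟨m| U |n⟩` of the linear-optics unitary `U` with mode matrix `A`, that is, of the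
operator with `U |0⟩ = |0⟩` and `U a_i† U† = ∑ j, A j i • a_j†`.  Since
`|n⟩ = (n!)^(-1/2) ∏ i, (a_i†)^(n i) |0⟩`, it is read off from the monomials of the polynomial
`∏ i, (∑ j, A j i • X_j) ^ (n i)`, where the monomial `X^m` stands for `(m!)^(1/2) |m⟩`. -/
def fockUnitary (A : Matrix ι ι ℂ) : Matrix (ι → ℕ) (ι → ℕ) ℂ := fun m n =>
  ((√(∏ i, ((m i)! : ℝ)) / √(∏ i, ((n i)! : ℝ)) : ℝ) : ℂ) *
    MvPolynomial.coeff (Finsupp.equivFunOnFinite.symm m)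
      (∏ i, (∑ j, MvPolynomial.C (A j i) * MvPolynomial.X j) ^ n i : MvPolynomial ι ℂ)

/-- The operator `U T U†`, for the linear-optics unitary `U` with mode matrix `A`.  The sums run
over the basis vectors with the same total photon number, as `⟨m| U |p⟩` vanishes for all
others. -/
def evolve [DecidableEq ι] (A : Matrix ι ι ℂ) (T : Matrix (ι → ℕ) (ι → ℕ) ℂ) :
    Matrix (ι → ℕ) (ι → ℕ) ℂ := fun m n =>
  ∑ p ∈ Finset.piAntidiag Finset.univ (∑ i, m i),
    ∑ q ∈ Finset.piAntidiag Finset.univ (∑ i, n i),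
      fockUnitary A m p * T p q * star (fockUnitary A n q)

/-- Density operators: positive semidefinite, with trace one. -/
structure IsState (ρ : Matrix (ι → ℕ) (ι → ℕ) ℂ) : Prop where
  posSemidef : ρ.PosSemidef
  trace_eq_one : HasSum (fun n => ρ n n) 1

/-- `ρ` is supported on the subspace with at most `N` photons in total. -/
def AtMostPhotons (N : ℕ) (ρ : Matrix (ι → ℕ) (ι → ℕ) ℂ) : Prop :=
  ∀ m n : ι → ℕ, N < ∑ i, m i ∨ N < ∑ i, n i → ρ m n = 0

/-- The Fock amplitudes `⟨n|γ⟩` of the multimode coherent state with amplitudes `γ i`. -/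
def coherentAmplitude (γ : ι → ℂ) (n : ι → ℕ) : ℂ :=
  ∏ i, (Real.exp (-‖γ i‖ ^ 2 / 2) : ℂ) * γ i ^ n i / (√((n i)! : ℝ) : ℂ)

end Fock

/-! ### The measurement configuration -/

/-- The `s + 1` modes of one path.  The mode `Sum.inl ()` is the one matched to the probe. -/
abbrev PathModes (s : ℕ) := Unit ⊕ Fin s

/-- The modes of two paths.  At the input, `Sum.inl` is the path of the unknown state and
`Sum.inr` that of the probe; at the output, `Sum.inl` goes to detector 1 and `Sum.inr` to
detector 2. -/
abbrev AllModes (s : ℕ) := PathModes s ⊕ PathModes s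

/-- The probe amplitudes: coherent amplitude `γ` in the matched mode, vacuum in the others. -/
def probeAmplitudes (s : ℕ) (γ : ℂ) : PathModes s → ℂ := Sum.elim (fun _ => γ) (fun _ => 0)

/-- The joint input state `ρ ⊗ |γ, 0, …, 0⟩⟨γ, 0, …, 0|`. -/
def jointInput {s : ℕ} (γ : ℂ) (ρ : Matrix (PathModes s → ℕ) (PathModes s → ℕ) ℂ) :
    Matrix (AllModes s → ℕ) (AllModes s → ℕ) ℂ := fun p q =>
  ρ (fun i => p (Sum.inl i)) (fun i => q (Sum.inl i)) *
    (coherentAmplitude (probeAmplitudes s γ) (fun i => p (Sum.inr i)) *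
      star (coherentAmplitude (probeAmplitudes s γ) (fun i => q (Sum.inr i))))

/-- The mode matrix of the beam splitter, acting identically on all modes:
`a_i ↦ η a_i + ζ b_i`, `b_i ↦ ζ a_i - η b_i`. -/
def beamSplitter (s : ℕ) (η ζ : ℝ) : Matrix (AllModes s) (AllModes s) ℂ :=
  Matrix.fromBlocks ((η : ℂ) • 1) ((ζ : ℂ) • 1) ((ζ : ℂ) • 1) (-((η : ℂ) • 1))

/-- The beam splitter is balanced: both coefficients have magnitude `1 / √2`. -/
def IsBalanced (η ζ : ℝ) : Prop := |η| = 1 / √2 ∧ |ζ| = 1 / √2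

/-- The output Fock vectors on which the two click detectors show the outcome `c`
(`true` is a click): a detector clicks iff there is a photon in some mode of its path. -/
def clickEvent (s : ℕ) (c : Bool × Bool) : Set (AllModes s → ℕ) :=
  {m | (c.1 = true ↔ ∃ i, m (Sum.inl i) ≠ 0) ∧ (c.2 = true ↔ ∃ i, m (Sum.inr i) ≠ 0)}

/-- The probability of the outcome `c` of the two click detectors, by Born's rule, for input state
`ρ` and probe amplitude `γ`. -/
def clickProb {s : ℕ} (η ζ : ℝ) (γ : ℂ) (ρ : Matrix (PathModes s → ℕ) (PathModes s → ℕ) ℂ)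
    (c : Bool × Bool) : ℝ :=
  ∑' m : clickEvent s c, (evolve (beamSplitter s η ζ) (jointInput γ ρ) m m).re

/-! ### The twirled state -/

section Haar

variable (s : ℕ)

instance unitaryMeasurableSpace : MeasurableSpace (Matrix.unitaryGroup (Fin s) ℂ) := borel _

instance unitaryBorelSpace : BorelSpace (Matrix.unitaryGroup (Fin s) ℂ) := ⟨rfl⟩

instance unitaryCompactSpace : CompactSpace (Matrix.unitaryGroup (Fin s) ℂ) := by
  have hK : IsCompact (Set.univ.pi fun _ : Fin s => Set.univ.pi fun _ : Fin s =>
      Metric.closedBall (0 : ℂ) 1) :=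
    isCompact_univ_pi fun _ => isCompact_univ_pi fun _ => isCompact_closedBall _ _
  have hc : IsClosed ((Matrix.unitaryGroup (Fin s) ℂ : Submonoid (Matrix (Fin s) (Fin s) ℂ)) :
      Set (Matrix (Fin s) (Fin s) ℂ)) := by
    have he : ((Matrix.unitaryGroup (Fin s) ℂ : Submonoid (Matrix (Fin s) (Fin s) ℂ)) :
        Set (Matrix (Fin s) (Fin s) ℂ)) = {A | A * star A = 1} := by
      ext A
      exact Matrix.mem_unitaryGroup_iff
    rw [he]
    exact isClosed_eq (continuous_id.mul continuous_star) continuous_const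
  have hs : IsCompact ((Matrix.unitaryGroup (Fin s) ℂ : Submonoid (Matrix (Fin s) (Fin s) ℂ)) :
      Set (Matrix (Fin s) (Fin s) ℂ)) := by
    refine hK.of_isClosed_subset hc fun A hA i _ j _ => ?_
    simpa using entry_norm_bound_of_unitary hA i j
  exact isCompact_iff_compactSpace.mp hs

/-- The Haar probability measure on `U(s)`. -/
def haarUnitary : MeasureTheory.Measure (Matrix.unitaryGroup (Fin s) ℂ) :=
  MeasureTheory.Measure.haarMeasure ⊤

end Haar

/-- The twirl of `ρ`: the Haar average of `ρ` over the passive unitaries that act on the `s` modes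
orthogonal to the probe and fix the matched mode. -/
def twirl {s : ℕ} (ρ : Matrix (PathModes s → ℕ) (PathModes s → ℕ) ℂ) :
    Matrix (PathModes s → ℕ) (PathModes s → ℕ) ℂ := fun m n =>
  ∫ V : Matrix.unitaryGroup (Fin s) ℂ,
    evolve (Matrix.fromBlocks 1 0 0 (V : Matrix (Fin s) (Fin s) ℂ)) ρ m n ∂(haarUnitary s)

/-- The operator `χ_n` of a state `ρ`: the (unnormalized) state of the matched mode, on the event
that there are `n` photons in total in the other `s` modes. -/
def conditional {s : ℕ} (ρ : Matrix (PathModes s → ℕ) (PathModes s → ℕ) ℂ) (n : ℕ) :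
    Matrix ℕ ℕ ℂ := fun i j =>
  ∑ r ∈ Finset.piAntidiag (Finset.univ : Finset (Fin s)) n,
    ρ (Sum.elim (fun _ => i) r) (Sum.elim (fun _ => j) r)

/-- The two-mode twirled state `∑ n, χ_n ⊗ |n⟩⟨n|` of the input state `ρ`, where the `χ_n` are
those of the twirl of `ρ`.  The second mode holds the photons of all modes orthogonal to the
probe. -/
def twirledTwoMode {s : ℕ} (ρ : Matrix (PathModes s → ℕ) (PathModes s → ℕ) ℂ) :
    Matrix (ℕ × ℕ) (ℕ × ℕ) ℂ := fun x y =>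
  if x.2 = y.2 then conditional (twirl ρ) x.2 x.1 y.1 else 0

/-- The two-mode twirled state of an input state with at most `N` photons is determined by the
joint outcome statistics of the two click detectors, known for all probe amplitudes. -/
def ClickStatisticsDetermine (s : ℕ) (η ζ : ℝ) (N : ℕ) : Prop :=
  ∀ ρ σ : Matrix (PathModes s → ℕ) (PathModes s → ℕ) ℂ,
    IsState ρ → IsState σ → AtMostPhotons N ρ → AtMostPhotons N σ →
    (∀ (γ : ℂ) (c : Bool × Bool), clickProb η ζ γ ρ c = clickProb η ζ γ σ c) →
    twirledTwoMode ρ = twirledTwoMode σ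

end WFH

end

/-!
Write `χ_n` for the operators of the matched mode in the twirled state. Averaging over the passive
unitaries of the other modes does not change them (`conditional_twirl`), since these unitaries act
unitarily on each photon number subspace. That linear-optics unitaries are unitary on Fock space
(`sum_fockUnitary_mul_star`) is read off from the Bargmann pairing of polynomials, for which
multiplication by `X_i` and the derivative `∂_i` are adjoint to each other
(`bargmannPairing_X_mul`).

If a path is dark, all photons leave through the other one, so that each input term contributes
with a single monomial of transmission coefficients (`fockUnitary_onPath`). A photon outside the
matched mode thus contributes a factor `u^2`, where `u` is `ζ` or `η`, and the probability of a dark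
path depends on the state only through the operator `∑ n, u^(2n) χ_n` (`hasSum_darkProb`).
Conversely, up to a Gaussian factor, that probability is a polynomial in the probe amplitude and
its conjugate, with the matrix entries of this operator as the coefficients of polynomials that
have different leading terms. Hence it determines the operator
(`weightedConditional_eq_of_darkProb_eq`). The statistics are therefore equivalent to the two
operators `∑ n, ζ^(2n) χ_n` and `∑ n, η^(2n) χ_n`, together with the vacuum probability
`⟨0| χ_0 |0⟩` (`weightedConditional_eq_of_clickProb_eq`, `clickProb_eq_of_weightedConditional_eq`).

With at most `N` photons, the entry `(i, j)` of `χ_n` vanishes for `n > N - max i j`. For `N = 2`,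
at most two unknown entries remain at each position, if the vacuum probability is used at `(0,
0)`, and the two equations determine them if `η^2 ≠ ζ^2`. For `N = 1` at most one unknown remains,
and one equation is enough. One photon more leaves a coherence between `0` and `1` photons in the
matched mode undetected: a nonzero polynomial with the roots `ζ^2` and `η^2`, which has degree
`2`, or `1` in the balanced case, provides values `c n` of this coherence in `χ_n` that both
equations annihilate. The states `coherenceState k d c` and `coherenceState k d (-c)` differ in
the sign of these coherences only (`not_clickStatisticsDetermine`).
-/

noncomputable section

namespace WFH

/-! ### The Bargmann pairing of polynomials -/

section Bargmann

theorem coeff_pderiv_eq {ι R : Type*} [CommRing R] (i : ι) (m : ι →₀ ℕ) (g : MvPolynomial ι R) :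
    MvPolynomial.coeff m (MvPolynomial.pderiv i g)
      = (m i + 1) * MvPolynomial.coeff (m + Finsupp.single i 1) g := by
  classical
  induction g using MvPolynomial.induction_on' with
  | add p q hp hq => simp [hp, hq, mul_add]
  | monomial n a =>
    rw [MvPolynomial.pderiv_monomial, MvPolynomial.coeff_monomial, MvPolynomial.coeff_monomial]
    by_cases h : n = m + Finsupp.single i 1
    · subst h
      simp [mul_comm]
    · rw [if_neg h, mul_zero]
      split_ifs with h'
      · by_cases hn : n i = 0
        · simp [hn]
        · refine absurd ?_ h
          rw [← h']
          ext k
          by_cases hk : i = k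
          · subst hk; simp; omega
          · simp [hk]
      · rfl

variable {ι : Type*} [Fintype ι] {R : Type*} [CommRing R]

/-- The bilinear form on polynomials with `⟨X^m, X^n⟩ = m!` if `m = n` and `0` otherwise.  In it,
the monomials `X^m / (m!)^(1/2)` of the Fock representation are orthonormal. -/
def bargmannPairing : MvPolynomial ι R →ₗ[R] MvPolynomial ι R →ₗ[R] R :=
  (MvPolynomial.basisMonomials ι R).constr R
    fun m => ((∏ i, (m i)! : ℕ) : R) • MvPolynomial.lcoeff R m

theorem bargmannPairing_monomial (m : ι →₀ ℕ) (a : R) (g : MvPolynomial ι R) :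
    bargmannPairing (MvPolynomial.monomial m a) g
      = a * ((∏ i, (m i)! : ℕ) : R) * MvPolynomial.coeff m g := by
  have h : (MvPolynomial.monomial m a : MvPolynomial ι R)
      = a • MvPolynomial.basisMonomials ι R m := by
    simp [MvPolynomial.smul_monomial]
  rw [h, map_smul, LinearMap.smul_apply, bargmannPairing, Module.Basis.constr_basis]
  simp [mul_assoc]

theorem prod_factorial_add_single (m : ι →₀ ℕ) (i : ι) :
    ∏ k, ((m + Finsupp.single i 1 : ι →₀ ℕ) k)! = (m i + 1) * ∏ k, (m k)! := by
  classical
  rw [← Finset.mul_prod_erase _ _ (Finset.mem_univ i),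
    ← Finset.mul_prod_erase (a := i) _ (fun k => (m k)!) (Finset.mem_univ i), ← mul_assoc]
  congr 1
  · simp [Nat.factorial_succ]
  · refine Finset.prod_congr rfl fun k hk => ?_
    have : i ≠ k := (Finset.ne_of_mem_erase hk).symm
    simp [this]

/-- Creation and annihilation operators are adjoint to each other. -/
theorem bargmannPairing_X_mul (i : ι) (f g : MvPolynomial ι R) :
    bargmannPairing (f * MvPolynomial.X i) g
      = bargmannPairing f (MvPolynomial.pderiv i g) := by
  induction f using MvPolynomial.induction_on' with
  | add p q hp hq => simp [add_mul, hp, hq]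
  | monomial n a =>
    rw [MvPolynomial.X, MvPolynomial.monomial_mul, bargmannPairing_monomial,
      bargmannPairing_monomial, prod_factorial_add_single, coeff_pderiv_eq]
    push_cast
    ring

/-- The substitution `X_i ↦ ∑ j, A j i • X_j`: the action of a mode matrix on the polynomials of
the Fock representation. -/
def modeSubst (A : Matrix ι ι R) : MvPolynomial ι R →ₐ[R] MvPolynomial ι R :=
  MvPolynomial.aeval fun i => ∑ j, MvPolynomial.C (A j i) * MvPolynomial.X j

theorem pderiv_modeSubst (A : Matrix ι ι R) (j : ι) (g : MvPolynomial ι R) :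
    MvPolynomial.pderiv j (modeSubst A g)
      = ∑ k, MvPolynomial.C (A j k) * modeSubst A (MvPolynomial.pderiv k g) := by
  classical
  induction g using MvPolynomial.induction_on with
  | C a => simp [modeSubst]
  | add p q hp hq => simp [hp, hq, mul_add, Finset.sum_add_distrib]
  | mul_X p i hp =>
    rw [map_mul, Derivation.leibniz, hp]
    simp only [Derivation.leibniz, map_add, smul_eq_mul, map_mul, mul_add,
      Finset.sum_add_distrib, MvPolynomial.pderiv_X]
    congr 1
    · have h1 : modeSubst A (MvPolynomial.X i) =
          ∑ j, MvPolynomial.C (A j i) * MvPolynomial.X j := by simp [modeSubst]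
      rw [h1]
      simp only [map_sum, Derivation.leibniz, MvPolynomial.pderiv_X, smul_eq_mul,
        MvPolynomial.pderiv_C, mul_zero, add_zero]
      simp only [Pi.single_apply, mul_ite, mul_one, mul_zero, Finset.sum_ite_eq', Finset.sum_ite_eq,
        apply_ite (modeSubst A), map_one, map_zero, Finset.mem_univ, if_true]
      ring
    · rw [Finset.mul_sum]
      refine Finset.sum_congr rfl fun k _ => by ring

theorem coeff_zero_modeSubst (A : Matrix ι ι R) (g : MvPolynomial ι R) :
    MvPolynomial.coeff 0 (modeSubst A g) = MvPolynomial.coeff 0 g := by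
  induction g using MvPolynomial.induction_on with
  | C a => simp [modeSubst]
  | add p q hp hq => simp [hp, hq]
  | mul_X p i hp =>
    rw [← MvPolynomial.constantCoeff_eq, map_mul, map_mul, map_mul]
    simp [modeSubst]

/-- Mode matrices that are inverse transposes of each other act by mutually adjoint inverses. -/
theorem bargmannPairing_modeSubst [DecidableEq ι] {A B : Matrix ι ι R} (h : A.transpose * B = 1)
    (f g : MvPolynomial ι R) :
    bargmannPairing (modeSubst A f) (modeSubst B g) = bargmannPairing f g := by
  induction f using MvPolynomial.induction_on generalizing g with
  | C a =>
    have : modeSubst A (MvPolynomial.C a) = MvPolynomial.monomial 0 a := by simp [modeSubst]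
    rw [this, bargmannPairing_monomial, ← MvPolynomial.monomial_zero', bargmannPairing_monomial,
      coeff_zero_modeSubst]
  | add p q hp hq => simp [hp, hq]
  | mul_X p i hp =>
    rw [map_mul, bargmannPairing_X_mul, ← hp]
    have h1 : modeSubst A (MvPolynomial.X i) = ∑ j, A j i • MvPolynomial.X j := by
      simp [modeSubst, MvPolynomial.smul_eq_C_mul]
    rw [h1, Finset.mul_sum, map_sum, LinearMap.sum_apply]
    simp only [mul_smul_comm, map_smul, LinearMap.smul_apply, bargmannPairing_X_mul,
      pderiv_modeSubst, map_sum, ← MvPolynomial.smul_eq_C_mul, Finset.smul_sum, smul_smul]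
    rw [Finset.sum_comm]
    simp only [← Finset.sum_smul]
    have h2 : ∀ k, ∑ j, A j i * B j k = if i = k then 1 else 0 := fun k => by
      have := congrFun (congrFun h i) k
      simpa [Matrix.mul_apply, Matrix.one_apply] using this
    simp [h2]

end Bargmann

/-! ### Unitarity of the Fock representation -/

section Unitarity

variable {ι : Type*} [Fintype ι]

theorem fockUnitary_eq_coeff (A : Matrix ι ι ℂ) (m n : ι → ℕ) :
    fockUnitary A m n = ((√(∏ i, ((m i)! : ℝ)) / √(∏ i, ((n i)! : ℝ)) : ℝ) : ℂ) *
      MvPolynomial.coeff (Finsupp.equivFunOnFinite.symm m)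
        (modeSubst A (MvPolynomial.monomial (Finsupp.equivFunOnFinite.symm n) 1)) := by
  rw [fockUnitary, modeSubst, MvPolynomial.aeval_monomial, Finsupp.prod_fintype _ _ (by simp)]
  simp

theorem isHomogeneous_modeSubst_monomial (A : Matrix ι ι ℂ) (n : ι → ℕ) :
    (modeSubst A (MvPolynomial.monomial (Finsupp.equivFunOnFinite.symm n) 1)).IsHomogeneous
      (∑ i, n i) := by
  rw [modeSubst, MvPolynomial.aeval_monomial, Finsupp.prod_fintype _ _ (by simp)]
  simp only [map_one, one_mul]
  refine MvPolynomial.IsHomogeneous.prod _ _ _ fun i _ => ?_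
  have : (∑ j, MvPolynomial.C (A j i) * MvPolynomial.X j).IsHomogeneous 1 :=
    MvPolynomial.IsHomogeneous.sum _ _ _ fun j _ => MvPolynomial.isHomogeneous_C_mul_X _ _
  simpa using this.pow (n i)

theorem star_coeff_modeSubst (A : Matrix ι ι ℂ) (n : ι → ℕ) (m : ι →₀ ℕ) :
    star (MvPolynomial.coeff m
      (modeSubst A (MvPolynomial.monomial (Finsupp.equivFunOnFinite.symm n) 1))) =
    MvPolynomial.coeff m
      (modeSubst (A.map star) (MvPolynomial.monomial (Finsupp.equivFunOnFinite.symm n) 1)) := by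
  have h : ∀ P : MvPolynomial ι ℂ, star (MvPolynomial.coeff m P) =
      MvPolynomial.coeff m (MvPolynomial.map (starRingEnd ℂ) P) := fun P => by
    rw [MvPolynomial.coeff_map]; rfl
  rw [h, modeSubst, modeSubst, MvPolynomial.aeval_monomial, MvPolynomial.aeval_monomial,
    Finsupp.prod_fintype _ _ (by simp), Finsupp.prod_fintype _ _ (by simp)]
  simp [map_prod]

theorem bargmannPairing_eq_sum {f : MvPolynomial ι ℂ} (g : MvPolynomial ι ℂ) {M : ℕ}
    [DecidableEq ι] (hf : f.IsHomogeneous M) :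
    bargmannPairing f g = ∑ m ∈ Finset.piAntidiag Finset.univ M,
      MvPolynomial.coeff (Finsupp.equivFunOnFinite.symm m) f * ((∏ i, (m i)! : ℕ) : ℂ) *
        MvPolynomial.coeff (Finsupp.equivFunOnFinite.symm m) g := by
  conv_lhs => rw [f.as_sum]
  rw [map_sum, LinearMap.sum_apply]
  simp only [bargmannPairing_monomial]
  refine Finset.sum_of_injOn (fun m => ⇑m) (fun a _ b _ h => DFunLike.coe_injective h) ?_ ?_ ?_
  · intro m hm
    have := hf (MvPolynomial.mem_support_iff.mp hm)
    refine Finset.mem_coe.mpr (Finset.mem_piAntidiag.mpr ⟨?_, by simp⟩)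
    rw [← this, Finsupp.weight_apply, Finsupp.sum_fintype _ _ (by simp)]
    simp
  · intro m _ hm
    have : MvPolynomial.coeff (Finsupp.equivFunOnFinite.symm m) f = 0 := by
      by_contra h
      exact hm ⟨_, MvPolynomial.mem_support_iff.mpr h, by simp⟩
    simp [this]
  · intro m _
    have : Finsupp.equivFunOnFinite.symm (⇑m) = m := by ext; simp
    simp [this]

/-- The columns of `fockUnitary A` with `M` photons are orthonormal if the columns of `A` are. -/
theorem sum_fockUnitary_mul_star [DecidableEq ι] {A : Matrix ι ι ℂ} (h : A.conjTranspose * A = 1)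
    {M : ℕ} (p q : ι → ℕ) (hp : ∑ i, p i = M) :
    ∑ m ∈ Finset.piAntidiag Finset.univ M, fockUnitary A m p * star (fockUnitary A m q)
      = if p = q then 1 else 0 := by
  have hstar : (A.transpose) * (A.map star) = 1 := by
    have := congrArg Matrix.transpose h
    rw [Matrix.transpose_mul] at this
    simpa [Matrix.conjTranspose, Matrix.transpose_map] using this
  have h1 := bargmannPairing_modeSubst hstar
    (MvPolynomial.monomial (Finsupp.equivFunOnFinite.symm p) 1)
    (MvPolynomial.monomial (Finsupp.equivFunOnFinite.symm q) 1)
  rw [bargmannPairing_eq_sum _ (hp ▸ isHomogeneous_modeSubst_monomial A p),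
    bargmannPairing_monomial, MvPolynomial.coeff_monomial] at h1
  have hfac : ∀ m : ι → ℕ, 0 < ∏ i, ((m i)! : ℝ) := fun m =>
    Finset.prod_pos fun i _ => by exact_mod_cast Nat.factorial_pos _
  have h2 : ∀ m, fockUnitary A m p * star (fockUnitary A m q) =
      (((√(∏ i, ((p i)! : ℝ)) * √(∏ i, ((q i)! : ℝ)))⁻¹ : ℝ) : ℂ) *
      (MvPolynomial.coeff (Finsupp.equivFunOnFinite.symm m)
        (modeSubst A (MvPolynomial.monomial (Finsupp.equivFunOnFinite.symm p) 1)) *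
      ((∏ i, (m i)! : ℕ) : ℂ) * MvPolynomial.coeff (Finsupp.equivFunOnFinite.symm m)
        (modeSubst (A.map star) (MvPolynomial.monomial (Finsupp.equivFunOnFinite.symm q) 1))) := by
    intro m
    rw [fockUnitary_eq_coeff, fockUnitary_eq_coeff, star_mul', star_coeff_modeSubst]
    have h3 : ((∏ i, (m i)! : ℕ) : ℂ) =
        ((√(∏ i, ((m i)! : ℝ)) * √(∏ i, ((m i)! : ℝ)) : ℝ) : ℂ) := by
      rw [Real.mul_self_sqrt (hfac m).le]; push_cast; rfl
    rw [h3, Complex.star_def, Complex.conj_ofReal]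
    push_cast
    rw [mul_inv]
    ring
  rw [Finset.sum_congr rfl fun m _ => h2 m, ← Finset.mul_sum, h1]
  by_cases hpq : p = q
  · subst hpq
    rw [Real.mul_self_sqrt (hfac p).le, if_pos rfl, if_pos rfl]
    have := (hfac p).ne'
    simp only [one_mul, mul_one]
    simp only [Finsupp.equivFunOnFinite_symm_apply_apply]
    rw [show ((∏ i, (p i)! : ℕ) : ℂ) = ((∏ i, ((p i)! : ℝ) : ℝ) : ℂ) by push_cast; rfl,
      ← Complex.ofReal_mul, inv_mul_cancel₀ this, Complex.ofReal_one]
  · rw [if_neg hpq, if_neg (fun h => hpq (Finsupp.equivFunOnFinite.symm.injective h).symm)]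
    simp

/-- A linear-optics unitary preserves the trace over the subspace with `M` photons. -/
theorem sum_evolve_diag [DecidableEq ι] {A : Matrix ι ι ℂ} (h : A.conjTranspose * A = 1)
    (T : Matrix (ι → ℕ) (ι → ℕ) ℂ) (M : ℕ) :
    ∑ m ∈ Finset.piAntidiag Finset.univ M, evolve A T m m
      = ∑ p ∈ Finset.piAntidiag Finset.univ M, T p p := by
  have h1 : ∀ m ∈ Finset.piAntidiag (Finset.univ : Finset ι) M, evolve A T m m =
      ∑ p ∈ Finset.piAntidiag Finset.univ M, ∑ q ∈ Finset.piAntidiag Finset.univ M,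
        T p q * (fockUnitary A m p * star (fockUnitary A m q)) := fun m hm => by
    have hm' : ∑ i, m i = M := (Finset.mem_piAntidiag.mp hm).1
    rw [evolve, hm']
    refine Finset.sum_congr rfl fun p _ => Finset.sum_congr rfl fun q _ => by ring
  rw [Finset.sum_congr rfl h1, Finset.sum_comm]
  refine Finset.sum_congr rfl fun p hp => ?_
  rw [Finset.sum_comm]
  simp only [← Finset.mul_sum]
  rw [Finset.sum_congr rfl fun q _ => by
    rw [sum_fockUnitary_mul_star h p q (Finset.mem_piAntidiag.mp hp).1]]
  simp [hp]

end Unitarity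

/-! ### Invariance of the conditional operators under twirling -/

section Twirl

variable {s : ℕ}

theorem coeff_X_pow_mul_rename_inr (a : ℕ) (g : MvPolynomial (Fin s) ℂ) (m : PathModes s → ℕ) :
    MvPolynomial.coeff (Finsupp.equivFunOnFinite.symm m)
      (MvPolynomial.X (Sum.inl ()) ^ a * MvPolynomial.rename (Sum.inr : Fin s → PathModes s) g)
      = if m (Sum.inl ()) = a then
          MvPolynomial.coeff (Finsupp.equivFunOnFinite.symm fun i => m (Sum.inr i)) g else 0 := by
  rw [MvPolynomial.X_pow_eq_monomial, MvPolynomial.coeff_monomial_mul']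
  by_cases h : m (Sum.inl ()) = a
  · have hle : Finsupp.single (Sum.inl ()) a ≤ Finsupp.equivFunOnFinite.symm m := by
      rw [Finsupp.single_le_iff]; simp [h]
    rw [if_pos hle, if_pos h, one_mul, ← MvPolynomial.coeff_rename_mapDomain
      (Sum.inr : Fin s → PathModes s) Sum.inr_injective]
    congr 1
    ext (i | i)
    · rw [Finsupp.mapDomain_of_notMem_range _ _ (by simp)]
      simp [h]
    · rw [Finsupp.mapDomain_apply Sum.inr_injective]
      simp
  · rw [if_neg h]
    split_ifs with hle
    · rw [one_mul]
      refine MvPolynomial.coeff_rename_eq_zero _ _ _ fun u hu => absurd ?_ h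
      have := DFunLike.congr_fun hu (Sum.inl ())
      rw [Finsupp.mapDomain_of_notMem_range _ _ (by simp)] at this
      rw [Finsupp.single_le_iff] at hle
      simp at this hle
      omega
    · rfl

theorem fockUnitary_fromBlocks_one (V : Matrix (Fin s) (Fin s) ℂ) (m p : PathModes s → ℕ) :
    fockUnitary (Matrix.fromBlocks 1 0 0 V) m p
      = if m (Sum.inl ()) = p (Sum.inl ()) then
          fockUnitary V (fun i => m (Sum.inr i)) (fun i => p (Sum.inr i)) else 0 := by
  have hpoly : (∏ i, (∑ j, MvPolynomial.C ((Matrix.fromBlocks 1 0 0 V :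
        Matrix (PathModes s) (PathModes s) ℂ) j i) * MvPolynomial.X j) ^ p i :
        MvPolynomial (PathModes s) ℂ)
      = MvPolynomial.X (Sum.inl ()) ^ p (Sum.inl ()) *
        MvPolynomial.rename (Sum.inr : Fin s → PathModes s)
          (∏ i, (∑ j, MvPolynomial.C (V j i) * MvPolynomial.X j) ^ p (Sum.inr i)) := by
    simp [Fintype.prod_sum_type, Fintype.sum_sum_type, map_prod]
  rw [fockUnitary, hpoly, coeff_X_pow_mul_rename_inr]
  split_ifs with h
  · rw [fockUnitary]
    congr 2
    rw [Fintype.prod_sum_type, Fintype.prod_sum_type, Real.sqrt_mul (by positivity),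
      Real.sqrt_mul (by positivity)]
    simp only [Finset.univ_unique, Finset.prod_singleton, PUnit.default_eq_unit, h]
    refine mul_div_mul_left _ _ ?_
    positivity
  · simp

theorem sum_pathModes (m : PathModes s → ℕ) :
    ∑ i, m i = m (Sum.inl ()) + ∑ i, m (Sum.inr i) := by
  simp [Fintype.sum_sum_type]

/-- A sum over the Fock vectors of one path that only sees those with `i` photons in the matched
mode. -/
theorem sum_piAntidiag_matched (i n : ℕ) (f : (PathModes s → ℕ) → ℂ)
    (hf : ∀ p, p (Sum.inl ()) ≠ i → f p = 0) :
    ∑ p ∈ Finset.piAntidiag Finset.univ (i + n), f p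
      = ∑ r ∈ Finset.piAntidiag (Finset.univ : Finset (Fin s)) n,
          f (Sum.elim (fun _ => i) r) := by
  symm
  refine Finset.sum_of_injOn (fun r => Sum.elim (fun _ => i) r) ?_ ?_ ?_ (fun _ _ => rfl)
  · intro a _ b _ h
    funext k
    exact congrFun h (Sum.inr k)
  · intro r hr
    have hr' := (Finset.mem_piAntidiag.mp (Finset.mem_coe.mp hr)).1
    refine Finset.mem_coe.mpr (Finset.mem_piAntidiag.mpr ⟨?_, by simp⟩)
    rw [sum_pathModes]
    simpa using hr'
  · intro p hp hnot
    refine hf p fun h => hnot ⟨fun k => p (Sum.inr k), ?_, ?_⟩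
    · have hp' := (Finset.mem_piAntidiag.mp hp).1
      rw [sum_pathModes, h] at hp'
      exact Finset.mem_coe.mpr (Finset.mem_piAntidiag.mpr ⟨by omega, by simp⟩)
    · funext k
      rcases k with k | k
      · simp [← h]
      · rfl

theorem evolve_fromBlocks_one (V : Matrix (Fin s) (Fin s) ℂ)
    (T : Matrix (PathModes s → ℕ) (PathModes s → ℕ) ℂ) (i j : ℕ) (r r' : Fin s → ℕ) :
    evolve (Matrix.fromBlocks 1 0 0 V) T (Sum.elim (fun _ => i) r) (Sum.elim (fun _ => j) r')
      = evolve V (fun a b => T (Sum.elim (fun _ => i) a) (Sum.elim (fun _ => j) b)) r r' := by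
  unfold evolve
  rw [sum_pathModes, sum_pathModes]
  simp only [Sum.elim_inl, Sum.elim_inr]
  rw [sum_piAntidiag_matched]
  · refine Finset.sum_congr rfl fun a _ => ?_
    rw [sum_piAntidiag_matched]
    · simp [fockUnitary_fromBlocks_one]
    · intro q hq
      simp [fockUnitary_fromBlocks_one, hq.symm]
  · intro p hp
    simp [fockUnitary_fromBlocks_one, hp.symm]

theorem conditional_evolve {V : Matrix (Fin s) (Fin s) ℂ} (hV : V.conjTranspose * V = 1)
    (T : Matrix (PathModes s → ℕ) (PathModes s → ℕ) ℂ) (n : ℕ) :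
    conditional (evolve (Matrix.fromBlocks 1 0 0 V) T) n = conditional T n := by
  ext i j
  simp only [conditional, evolve_fromBlocks_one]
  exact sum_evolve_diag hV _ n

theorem continuous_coeff_modeMatrix {ι : Type*} [Fintype ι] (m : ι →₀ ℕ) (n : ι → ℕ) :
    Continuous fun A : Matrix ι ι ℂ => MvPolynomial.coeff m
      (∏ i, (∑ j, MvPolynomial.C (A j i) * MvPolynomial.X j) ^ n i : MvPolynomial ι ℂ) := by
  classical
  -- polynomials whose coefficients depend continuously on `A` are closed under products
  have hmul : ∀ f g : Matrix ι ι ℂ → MvPolynomial ι ℂ,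
      (∀ m, Continuous fun A => MvPolynomial.coeff m (f A)) →
      (∀ m, Continuous fun A => MvPolynomial.coeff m (g A)) →
      ∀ m, Continuous fun A => MvPolynomial.coeff m (f A * g A) := by
    intro f g hf hg m
    simp only [MvPolynomial.coeff_mul]
    exact continuous_finsetSum _ fun x _ => (hf _).mul (hg _)
  have hpow : ∀ (f : Matrix ι ι ℂ → MvPolynomial ι ℂ) (k : ℕ),
      (∀ m, Continuous fun A => MvPolynomial.coeff m (f A)) →
      ∀ m, Continuous fun A => MvPolynomial.coeff m (f A ^ k) := by
    intro f k hf
    induction k with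
    | zero => intro m; simpa using continuous_const
    | succ k ih => intro m; simp only [pow_succ]; exact hmul _ _ ih hf m
  have hprod : ∀ (t : Finset ι) (m : ι →₀ ℕ), Continuous fun A : Matrix ι ι ℂ =>
      MvPolynomial.coeff m
        (∏ i ∈ t, (∑ j, MvPolynomial.C (A j i) * MvPolynomial.X j) ^ n i : MvPolynomial ι ℂ) := by
    intro t
    induction t using Finset.induction_on with
    | empty => intro m; simpa using continuous_const
    | insert i t hi ih =>
      intro m
      simp only [Finset.prod_insert hi]
      refine hmul _ _ (hpow _ _ fun m => ?_) ih m
      simp only [MvPolynomial.coeff_sum, MvPolynomial.coeff_C_mul]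
      exact continuous_finsetSum _ fun j _ => (continuous_id.matrix_elem j i).mul continuous_const
  exact hprod Finset.univ m

theorem continuous_evolve {ι : Type*} [Fintype ι] [DecidableEq ι]
    (T : Matrix (ι → ℕ) (ι → ℕ) ℂ) (m n : ι → ℕ) :
    Continuous fun A : Matrix ι ι ℂ => evolve A T m n := by
  have h : ∀ m n : ι → ℕ, Continuous fun A : Matrix ι ι ℂ => fockUnitary A m n := fun m n =>
    continuous_const.mul (continuous_coeff_modeMatrix _ n)
  unfold evolve
  exact continuous_finsetSum _ fun p _ => continuous_finsetSum _ fun q _ =>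
    ((h m p).mul continuous_const).mul (h n q).star

instance isProbabilityMeasure_haarUnitary :
    MeasureTheory.IsProbabilityMeasure (haarUnitary s) := by
  refine ⟨?_⟩
  have := MeasureTheory.Measure.haarMeasure_self
    (K₀ := (⊤ : TopologicalSpace.PositiveCompacts (Matrix.unitaryGroup (Fin s) ℂ)))
  simpa [haarUnitary] using this

/-- Passive unitaries on the other modes preserve the trace over each photon number subspace of
those modes, hence so does their average. -/
theorem conditional_twirl (T : Matrix (PathModes s → ℕ) (PathModes s → ℕ) ℂ) (n : ℕ) :
    conditional (twirl T) n = conditional T n := by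
  ext i j
  have hc : ∀ r : Fin s → ℕ, Continuous fun V : Matrix.unitaryGroup (Fin s) ℂ =>
      evolve (Matrix.fromBlocks 1 0 0 (V : Matrix (Fin s) (Fin s) ℂ)) T
        (Sum.elim (fun _ => i) r) (Sum.elim (fun _ => j) r) := fun r => by
    simp only [evolve_fromBlocks_one]
    exact (continuous_evolve _ r r).comp continuous_subtype_val
  have h1 : conditional (twirl T) n i j = ∫ V : Matrix.unitaryGroup (Fin s) ℂ,
      conditional (evolve (Matrix.fromBlocks 1 0 0 (V : Matrix (Fin s) (Fin s) ℂ)) T) n i j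
        ∂(haarUnitary s) := by
    simp only [conditional, twirl]
    rw [MeasureTheory.integral_finsetSum]
    exact fun r _ => (hc r).integrable_of_hasCompactSupport (HasCompactSupport.of_compactSpace _)
  rw [h1]
  have h2 : ∀ V : Matrix.unitaryGroup (Fin s) ℂ,
      conditional (evolve (Matrix.fromBlocks 1 0 0 (V : Matrix (Fin s) (Fin s) ℂ)) T) n i j
        = conditional T n i j := fun V => by
    rw [conditional_evolve]
    exact Matrix.UnitaryGroup.star_mul_self V
  simp [h2]

end Twirl

/-! ### Output vectors with one dark path -/

section DarkPath

theorem coeff_mapDomain_eq_coeff_killCompl {σ τ : Type*} {f : σ → τ} (hf : Function.Injective f)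
    (x : σ →₀ ℕ) (P : MvPolynomial τ ℂ) :
    MvPolynomial.coeff (x.mapDomain f) P = MvPolynomial.coeff x (MvPolynomial.killCompl hf P) := by
  classical
  induction P using MvPolynomial.induction_on' with
  | add p q hp hq => simp [hp, hq]
  | monomial n a =>
    by_cases hn : (n.support : Set τ) ⊆ Set.range f
    · have h : n = (n.comapDomain f hf.injOn).mapDomain f :=
        (Finsupp.mapDomain_comapDomain f hf n hn).symm
      rw [h, MvPolynomial.killCompl_monomial_mapDomain, MvPolynomial.coeff_monomial,
        MvPolynomial.coeff_monomial]
      simp only [(Finsupp.mapDomain_injective hf).eq_iff]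
    · rw [MvPolynomial.killCompl_monomial_eq_zero_of_not_subset hf a hn,
        MvPolynomial.coeff_monomial, if_neg, MvPolynomial.coeff_zero]
      rintro rfl
      refine hn fun j hj => ?_
      obtain ⟨k, _, hk⟩ := Finset.mem_image.mp (Finsupp.mapDomain_support hj)
      exact ⟨k, hk⟩

variable {s : ℕ}

/-- The modes `f k` form an output path: the mode `f k` receives the photons of the state mode `k`
with amplitude `u`, those of the probe mode `k` with amplitude `v`, and no others. -/
structure IsOutputPath (A : Matrix (AllModes s) (AllModes s) ℂ) (f : PathModes s → AllModes s)
    (u v : ℝ) : Prop where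
  injective : Function.Injective f
  apply_inl : ∀ k i, A (f k) (Sum.inl i) = if k = i then (u : ℂ) else 0
  apply_inr : ∀ k i, A (f k) (Sum.inr i) = if k = i then (v : ℂ) else 0

theorem isOutputPath_inr (η ζ : ℝ) :
    IsOutputPath (beamSplitter s η ζ) Sum.inr ζ (-η) where
  injective := Sum.inr_injective
  apply_inl k i := by simp [beamSplitter, Matrix.one_apply]
  apply_inr k i := by
    by_cases h : k = i <;> simp [beamSplitter, h]

theorem isOutputPath_inl (η ζ : ℝ) :
    IsOutputPath (beamSplitter s η ζ) Sum.inl η ζ where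
  injective := Sum.inl_injective
  apply_inl k i := by simp [beamSplitter, Matrix.one_apply]
  apply_inr k i := by simp [beamSplitter, Matrix.one_apply]

/-- The Fock vector with occupation numbers `x` on the path `f` and no photons elsewhere. -/
def onPath (f : PathModes s → AllModes s) (x : PathModes s → ℕ) : AllModes s → ℕ :=
  Function.extend f x 0

variable {A : Matrix (AllModes s) (AllModes s) ℂ} {f : PathModes s → AllModes s} {u v : ℝ}

theorem onPath_apply (hf : Function.Injective f) (x : PathModes s → ℕ) (k : PathModes s) :
    onPath f x (f k) = x k :=
  hf.extend_apply x 0 k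

theorem onPath_apply_of_notMem {x : PathModes s → ℕ} {j : AllModes s} (hj : j ∉ Set.range f) :
    onPath f x j = 0 :=
  Function.extend_apply' _ _ _ hj

theorem onPath_injective (hf : Function.Injective f) : Function.Injective (onPath f) :=
  fun x y h => funext fun k => by
    rw [← onPath_apply hf x k, h, onPath_apply hf y k]

theorem symm_onPath (hf : Function.Injective f) (x : PathModes s → ℕ) :
    Finsupp.equivFunOnFinite.symm (onPath f x)
      = (Finsupp.equivFunOnFinite.symm x).mapDomain f := by
  ext j
  by_cases hj : j ∈ Set.range f
  · obtain ⟨k, rfl⟩ := hj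
    rw [Finsupp.mapDomain_apply hf]
    simp [onPath_apply hf]
  · rw [Finsupp.mapDomain_of_notMem_range _ _ hj]
    simp [onPath_apply_of_notMem hj]

theorem sum_onPath (hf : Function.Injective f) (x : PathModes s → ℕ) :
    ∑ j, onPath f x j = ∑ k, x k :=
  (Finset.sum_of_injOn f hf.injOn (by simp)
    (fun j _ hj => onPath_apply_of_notMem (by simpa using hj))
    (fun k _ => (onPath_apply hf x k).symm)).symm

theorem prod_factorial_onPath (hf : Function.Injective f) (x : PathModes s → ℕ) :
    ∏ j, ((onPath f x j)! : ℝ) = ∏ k, ((x k)! : ℝ) :=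
  (Finset.prod_of_injOn f hf.injOn (by simp)
    (fun j _ hj => by rw [onPath_apply_of_notMem (by simpa using hj)]; simp)
    (fun k _ => by rw [onPath_apply hf x k])).symm

theorem killCompl_linearForm (hA : IsOutputPath A f u v) (i : PathModes s ⊕ PathModes s) :
    MvPolynomial.killCompl hA.injective
        (∑ j, MvPolynomial.C (A j i) * MvPolynomial.X j : MvPolynomial (AllModes s) ℂ)
      = MvPolynomial.C (Sum.elim (fun _ => (u : ℂ)) (fun _ => (v : ℂ)) i) *
          MvPolynomial.X (Sum.elim id id i) := by
  have h1 : MvPolynomial.killCompl hA.injective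
        (∑ j, MvPolynomial.C (A j i) * MvPolynomial.X j : MvPolynomial (AllModes s) ℂ)
      = ∑ k, MvPolynomial.C (A (f k) i) * MvPolynomial.X k := by
    rw [map_sum]
    symm
    refine Finset.sum_of_injOn f hA.injective.injOn (by simp) (fun j _ hj => ?_) (fun k _ => ?_)
    · rw [map_mul, MvPolynomial.killCompl, MvPolynomial.aeval_X, dif_neg (by simpa using hj),
        mul_zero]
    · rw [map_mul, MvPolynomial.killCompl_C, ← MvPolynomial.rename_X f,
        MvPolynomial.killCompl_rename_app]
  rw [h1]
  rcases i with i | i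
  · simp [hA.apply_inl, apply_ite MvPolynomial.C]
  · simp [hA.apply_inr, apply_ite MvPolynomial.C]

/-- All photons of a term that ends on the path `f` are transmitted into it: the amplitude is a
single monomial in `u` and `v`. -/
theorem fockUnitary_onPath (hA : IsOutputPath A f u v) (x : PathModes s → ℕ)
    (p : AllModes s → ℕ) :
    fockUnitary A (onPath f x) p
      = if (fun k => p (Sum.inl k) + p (Sum.inr k)) = x then
          ((√(∏ k, ((x k)! : ℝ)) / √(∏ i, ((p i)! : ℝ)) : ℝ) : ℂ) *
            ((u : ℂ) ^ (∑ k, p (Sum.inl k)) * (v : ℂ) ^ (∑ k, p (Sum.inr k))) else 0 := by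
  have hmon : MvPolynomial.killCompl hA.injective
      (∏ i, (∑ j, MvPolynomial.C (A j i) * MvPolynomial.X j) ^ p i : MvPolynomial (AllModes s) ℂ)
      = MvPolynomial.monomial
          (Finsupp.equivFunOnFinite.symm fun k => p (Sum.inl k) + p (Sum.inr k))
          ((u : ℂ) ^ (∑ k, p (Sum.inl k)) * (v : ℂ) ^ (∑ k, p (Sum.inr k))) := by
    simp only [map_prod, map_pow, killCompl_linearForm hA]
    rw [Fintype.prod_sum_type, MvPolynomial.monomial_eq, Finsupp.prod_fintype _ _ (by simp)]
    simp only [Sum.elim_inl, Sum.elim_inr, mul_pow, Finset.prod_mul_distrib, id,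
      Finsupp.equivFunOnFinite_symm_apply_apply, pow_add, Finset.prod_pow_eq_pow_sum, map_mul,
      map_pow]
    ring
  rw [fockUnitary, symm_onPath hA.injective, coeff_mapDomain_eq_coeff_killCompl hA.injective, hmon,
    MvPolynomial.coeff_monomial, prod_factorial_onPath hA.injective]
  simp only [EmbeddingLike.apply_eq_iff_eq]
  split_ifs <;> simp

theorem coherentAmplitude_probe (γ : ℂ) (k : ℕ) :
    coherentAmplitude (probeAmplitudes s γ) (Sum.elim (fun _ => k) 0)
      = (Real.exp (-‖γ‖ ^ 2 / 2) : ℂ) * γ ^ k / (√(k ! : ℝ) : ℂ) := by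
  simp [coherentAmplitude, probeAmplitudes, Fintype.prod_sum_type]

theorem coherentAmplitude_probe_eq_zero (γ : ℂ) {y : PathModes s → ℕ} {j : Fin s}
    (hy : y (Sum.inr j) ≠ 0) : coherentAmplitude (probeAmplitudes s γ) y = 0 := by
  rw [coherentAmplitude, Fintype.prod_sum_type]
  refine mul_eq_zero_of_right _ (Finset.prod_eq_zero (Finset.mem_univ j) ?_)
  simp [probeAmplitudes, hy]

/-- The amplitude with which `i` photons in the matched state mode and the coherent probe `γ` lead
to `M` photons in an output mode that receives them with coefficients `u` and `v`, the other output
mode being empty. -/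
def transferAmplitude (u v : ℝ) (γ : ℂ) (M i : ℕ) : ℂ :=
  (Real.exp (-‖γ‖ ^ 2 / 2) : ℂ) * ((M.choose i * √(i ! : ℝ) / √(M ! : ℝ) : ℝ) : ℂ) *
    ((u : ℂ) ^ i * ((v : ℂ) * γ) ^ (M - i))

theorem fockUnitary_onPath_mul_coherentAmplitude (hA : IsOutputPath A f u v) (γ : ℂ)
    (i k : ℕ) (r : Fin s → ℕ) :
    fockUnitary A (onPath f (Sum.elim (fun _ => i + k) r))
        (Sum.elim (Sum.elim (fun _ => i) r) (Sum.elim (fun _ => k) 0)) *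
      coherentAmplitude (probeAmplitudes s γ) (Sum.elim (fun _ => k) 0)
      = (u : ℂ) ^ (∑ l, r l) * transferAmplitude u v γ (i + k) i := by
  have hx : (fun l => (Sum.elim (Sum.elim (fun _ => i) r) (Sum.elim (fun _ => k) 0) :
      AllModes s → ℕ) (Sum.inl l) + (Sum.elim (Sum.elim (fun _ => i) r) (Sum.elim (fun _ => k) 0) :
      AllModes s → ℕ) (Sum.inr l)) = (Sum.elim (fun _ => i + k) r : PathModes s → ℕ) := by
    funext l
    rcases l with l | l <;> simp
  rw [fockUnitary_onPath hA, if_pos hx, coherentAmplitude_probe, transferAmplitude]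
  have hr : (0 : ℝ) < ∏ l, ((r l)! : ℝ) :=
    Finset.prod_pos fun l _ => by exact_mod_cast Nat.factorial_pos _
  have hreal : √((i + k)! * ∏ l, ((r l)! : ℝ)) / √((i ! * ∏ l, ((r l)! : ℝ)) * k !) / √(k ! : ℝ)
      = (i + k).choose i * √(i ! : ℝ) / √((i + k)! : ℝ) := by
    have hi : (0 : ℝ) < i ! := by exact_mod_cast Nat.factorial_pos _
    have hk : (0 : ℝ) < k ! := by exact_mod_cast Nat.factorial_pos _
    have hik : (0 : ℝ) < (i + k)! := by exact_mod_cast Nat.factorial_pos _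
    rw [Real.sqrt_mul hik.le, Real.sqrt_mul (by positivity), Real.sqrt_mul hi.le,
      Nat.choose_symm_add, Nat.add_choose,
      Nat.cast_div (Nat.factorial_mul_factorial_dvd_factorial_add i k) (by positivity)]
    push_cast
    have h1 := Real.sq_sqrt hi.le
    have h2 := Real.sq_sqrt hk.le
    have h3 := Real.sq_sqrt hik.le
    have := (Real.sqrt_pos.mpr hi).ne'
    have := (Real.sqrt_pos.mpr hk).ne'
    have := (Real.sqrt_pos.mpr hik).ne'
    have := (Real.sqrt_pos.mpr hr).ne'
    field_simp
    rw [h1, h2, h3]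
    ring
  simp only [Fintype.prod_sum_type, Fintype.sum_sum_type, Sum.elim_inl, Sum.elim_inr,
    Finset.univ_unique, Finset.prod_singleton, Finset.sum_singleton, Pi.zero_apply,
    Nat.factorial_zero, Nat.cast_one, Finset.prod_const_one, mul_one, Finset.sum_const_zero,
    add_zero]
  rw [← hreal, Nat.add_sub_cancel_left]
  push_cast
  rw [mul_pow, pow_add]
  ring

/-- The input amplitudes that reach `M` photons in the matched mode and the occupation numbers `r`
in the other modes of the path `f`. -/
theorem sum_fockUnitary_onPath (hA : IsOutputPath A f u v) (γ : ℂ) (M : ℕ) (r : Fin s → ℕ)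
    (h : (PathModes s → ℕ) → ℂ) :
    ∑ p ∈ Finset.piAntidiag Finset.univ (M + ∑ l, r l),
      fockUnitary A (onPath f (Sum.elim (fun _ => M) r)) p *
        coherentAmplitude (probeAmplitudes s γ) (fun k => p (Sum.inr k)) *
          h (fun k => p (Sum.inl k))
      = ∑ i ∈ Finset.range (M + 1), (u : ℂ) ^ (∑ l, r l) * transferAmplitude u v γ M i *
          h (Sum.elim (fun _ => i) r) := by
  rw [← Finset.Nat.sum_antidiagonal_eq_sum_range_succ_mk (n := M)
    (f := fun ik => (u : ℂ) ^ (∑ l, r l) * transferAmplitude u v γ M ik.1 *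
          h (Sum.elim (fun _ => ik.1) r))]
  symm
  refine Finset.sum_of_injOn
    (fun ik => Sum.elim (Sum.elim (fun _ => ik.1) r) (Sum.elim (fun _ => ik.2) 0)) ?_ ?_ ?_ ?_
  · rintro ⟨i, k⟩ _ ⟨i', k'⟩ _ heq
    have h1 := congrFun heq (Sum.inl (Sum.inl ()))
    have h2 := congrFun heq (Sum.inr (Sum.inl ()))
    simp at h1 h2
    simp [h1, h2]
  · rintro ⟨i, k⟩ hik
    have hik' : i + k = M := by simpa using hik
    refine Finset.mem_coe.mpr (Finset.mem_piAntidiag.mpr ⟨?_, by simp⟩)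
    simp [Fintype.sum_sum_type, ← hik']
    ring
  · intro p hp hnot
    by_cases hr : ∃ j, p (Sum.inr (Sum.inr j)) ≠ 0
    · obtain ⟨j, hj⟩ := hr
      rw [coherentAmplitude_probe_eq_zero γ (y := fun k => p (Sum.inr k)) hj]
      simp
    · push Not at hr
      rw [fockUnitary_onPath hA, if_neg]
      · simp
      · intro hx
        refine hnot ⟨(p (Sum.inl (Sum.inl ())), p (Sum.inr (Sum.inl ()))), ?_, ?_⟩
        · have := congrFun hx (Sum.inl ())
          simpa using this
        · funext k
          rcases k with (k | k) | (k | k)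
          · rfl
          · have := congrFun hx (Sum.inr k)
            simp only [hr, add_zero, Sum.elim_inr] at this
            simp [this]
          · rfl
          · simp [hr]
  · rintro ⟨i, k⟩ hik
    have hik' : i + k = M := by simpa using hik
    subst hik'
    have := fockUnitary_onPath_mul_coherentAmplitude hA γ i k r
    simp only [Sum.elim_inl, Sum.elim_inr]
    rw [← this]

/-- The output probability of the Fock vector with `M` photons in the matched mode and the
occupation numbers `r` in the other modes of the path `f`, the other path being dark. -/
theorem evolve_onPath (hA : IsOutputPath A f u v) (γ : ℂ)
    (ρ : Matrix (PathModes s → ℕ) (PathModes s → ℕ) ℂ) (M : ℕ) (r : Fin s → ℕ) :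
    evolve A (jointInput γ ρ) (onPath f (Sum.elim (fun _ => M) r))
        (onPath f (Sum.elim (fun _ => M) r))
      = ∑ i ∈ Finset.range (M + 1), ∑ j ∈ Finset.range (M + 1),
          transferAmplitude u v γ M i * star (transferAmplitude u v γ M j) *
            (((u : ℂ) ^ 2) ^ (∑ l, r l) *
              ρ (Sum.elim (fun _ => i) r) (Sum.elim (fun _ => j) r)) := by
  have hM : ∑ l, onPath f (Sum.elim (fun _ => M) r) l = M + ∑ l, r l := by
    rw [sum_onPath hA.injective, sum_pathModes]; simp
  rw [evolve, hM]
  have h1 : ∀ p : AllModes s → ℕ, ∑ q ∈ Finset.piAntidiag Finset.univ (M + ∑ l, r l),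
      fockUnitary A (onPath f (Sum.elim (fun _ => M) r)) p * jointInput γ ρ p q *
        star (fockUnitary A (onPath f (Sum.elim (fun _ => M) r)) q)
      = fockUnitary A (onPath f (Sum.elim (fun _ => M) r)) p *
        coherentAmplitude (probeAmplitudes s γ) (fun k => p (Sum.inr k)) *
        ∑ j ∈ Finset.range (M + 1), star ((u : ℂ) ^ (∑ l, r l) * transferAmplitude u v γ M j) *
          ρ (fun k => p (Sum.inl k)) (Sum.elim (fun _ => j) r) := fun p => by
    have := congrArg star (sum_fockUnitary_onPath hA γ M r
      (fun y => star (ρ (fun k => p (Sum.inl k)) y)))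
    simp only [star_sum, star_mul', star_star] at this
    simp only [star_mul']
    rw [← this, Finset.mul_sum]
    refine Finset.sum_congr rfl fun q _ => ?_
    rw [jointInput]
    ring
  rw [Finset.sum_congr rfl fun p _ => h1 p,
    sum_fockUnitary_onPath hA γ M r (fun y => ∑ j ∈ Finset.range (M + 1),
      star ((u : ℂ) ^ (∑ l, r l) * transferAmplitude u v γ M j) *
          ρ y (Sum.elim (fun _ => j) r))]
  refine Finset.sum_congr rfl fun i _ => ?_
  rw [Finset.mul_sum]
  refine Finset.sum_congr rfl fun j _ => ?_
  simp only [star_mul', star_pow, Complex.star_def, Complex.conj_ofReal]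
  ring

end DarkPath

/-! ### Outcome probabilities -/

section Probabilities

theorem pairwiseDisjoint_piAntidiag {ι : Type*} [Fintype ι] [DecidableEq ι] (t : Set ℕ) :
    t.PairwiseDisjoint fun n => Finset.piAntidiag (Finset.univ : Finset ι) n :=
  fun _ _ _ _ hab => Finset.disjoint_left.mpr fun _ ha hb =>
    hab ((Finset.mem_piAntidiag.mp ha).1.symm.trans (Finset.mem_piAntidiag.mp hb).1)

/-- Nonnegative families with the same sum over each photon number subspace have the same total
sum. -/
theorem hasSum_of_sum_piAntidiag_eq {ι : Type*} [Fintype ι] [DecidableEq ι]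
    {f g : (ι → ℕ) → ℝ} {a : ℝ} (hf : HasSum f a) (hf0 : ∀ m, 0 ≤ f m) (hg0 : ∀ m, 0 ≤ g m)
    (hfg : ∀ M, ∑ m ∈ Finset.piAntidiag Finset.univ M, g m
      = ∑ m ∈ Finset.piAntidiag Finset.univ M, f m) : HasSum g a := by
  have hdisj : ∀ K : ℕ, Set.PairwiseDisjoint (Finset.range K : Set ℕ)
      fun M => Finset.piAntidiag (Finset.univ : Finset ι) M := fun K =>
    pairwiseDisjoint_piAntidiag _
  have hsum : Summable g := by
    refine summable_of_sum_le hg0 (c := a) fun t => ?_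
    let K := t.sup (fun m => ∑ i, m i) + 1
    have hsub : t ⊆ (Finset.range K).biUnion
        fun M => Finset.piAntidiag (Finset.univ : Finset ι) M := fun m hm => by
      refine Finset.mem_biUnion.mpr ⟨∑ i, m i, ?_, Finset.mem_piAntidiag.mpr ⟨rfl, by simp⟩⟩
      exact Finset.mem_range.mpr
        (Nat.lt_succ_of_le (Finset.le_sup (f := fun m : ι → ℕ => ∑ i, m i) hm))
    calc ∑ m ∈ t, g m
        ≤ ∑ m ∈ (Finset.range K).biUnion fun M => Finset.piAntidiag (Finset.univ : Finset ι) M,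
            g m := Finset.sum_le_sum_of_subset_of_nonneg hsub fun m _ _ => hg0 m
      _ = ∑ m ∈ (Finset.range K).biUnion fun M => Finset.piAntidiag (Finset.univ : Finset ι) M,
            f m := by
          rw [Finset.sum_biUnion (hdisj K), Finset.sum_biUnion (hdisj K)]
          exact Finset.sum_congr rfl fun M _ => hfg M
      _ ≤ a := sum_le_hasSum _ (fun m _ => hf0 m) hf
  have h1 := hf.tsum_fiberwise fun m : ι → ℕ => ∑ i, m i
  have h2 := hsum.hasSum.tsum_fiberwise fun m : ι → ℕ => ∑ i, m i
  have hfib : ∀ M : ℕ, (fun m : ι → ℕ => ∑ i, m i) ⁻¹' {M}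
      = ((Finset.piAntidiag (Finset.univ : Finset ι) M : Finset (ι → ℕ)) : Set (ι → ℕ)) := by
    intro M; ext m; simp
  have h3 : (fun M : ℕ => ∑' b : (fun m : ι → ℕ => ∑ i, m i) ⁻¹' {M}, g b)
      = fun M : ℕ => ∑' b : (fun m : ι → ℕ => ∑ i, m i) ⁻¹' {M}, f b := by
    funext M
    rw [hfib, Finset.tsum_subtype', Finset.tsum_subtype', hfg]
  rw [h3] at h2
  rw [h1.unique h2]
  exact hsum.hasSum

variable {s : ℕ}

theorem conjTranspose_beamSplitter_mul {η ζ : ℝ} (h : η ^ 2 + ζ ^ 2 = 1) :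
    (beamSplitter s η ζ).conjTranspose * beamSplitter s η ζ = 1 := by
  have h1 : (η : ℂ) * η + (ζ : ℂ) * ζ = 1 := by
    rw [← sq, ← sq]; exact_mod_cast h
  have hstar : (beamSplitter s η ζ).conjTranspose = beamSplitter s η ζ := by
    rw [beamSplitter, Matrix.fromBlocks_conjTranspose]
    simp [Matrix.conjTranspose_smul]
  rw [hstar]
  refine Eq.trans ?_ (Matrix.fromBlocks_one (α := ℂ))
  rw [beamSplitter, Matrix.fromBlocks_multiply]
  simp only [smul_mul_smul_comm, mul_one, ← add_smul, mul_neg, neg_mul, neg_neg, ← neg_smul]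
  congr 1
  · rw [h1, one_smul]
  · rw [mul_comm, add_neg_cancel, zero_smul]
  · rw [mul_comm, add_neg_cancel, zero_smul]
  · rw [add_comm, h1, one_smul]

theorem evolve_jointInput_diag_nonneg {ρ : Matrix (PathModes s → ℕ) (PathModes s → ℕ) ℂ}
    (hρ : ρ.PosSemidef) (A : Matrix (AllModes s) (AllModes s) ℂ) (γ : ℂ) (m : AllModes s → ℕ) :
    0 ≤ evolve A (jointInput γ ρ) m m := by
  let S := Finset.piAntidiag (Finset.univ : Finset (AllModes s)) (∑ i, m i)
  let x : S → ℂ := fun p => star (fockUnitary A m p *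
    coherentAmplitude (probeAmplitudes s γ) (fun k => p.1 (Sum.inr k)))
  have h := (hρ.submatrix (fun p : S => fun k => p.1 (Sum.inl k))).dotProduct_mulVec_nonneg x
  convert h using 1
  rw [evolve]
  simp only [dotProduct, Matrix.mulVec, Finset.mul_sum, Matrix.submatrix_apply, Pi.star_apply, x,
    star_star]
  rw [← Finset.sum_coe_sort]
  refine Finset.sum_congr rfl fun p _ => ?_
  rw [← Finset.sum_coe_sort]
  refine Finset.sum_congr rfl fun q _ => ?_
  rw [jointInput, star_mul']
  ring

theorem hasSum_coherentAmplitude_probe (γ : ℂ) :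
    HasSum (fun y : PathModes s → ℕ => coherentAmplitude (probeAmplitudes s γ) y *
      star (coherentAmplitude (probeAmplitudes s γ) y)) 1 := by
  let e : ℕ → (PathModes s → ℕ) := fun k => Sum.elim (fun _ => k) 0
  have he : Function.Injective e := fun k l h => congrFun h (Sum.inl ())
  rw [← he.hasSum_iff]
  · have h := (NormedSpace.expSeries_div_hasSum_exp ((‖γ‖ ^ 2 : ℝ) : ℂ)).mul_left
      ((Real.exp (-‖γ‖ ^ 2) : ℝ) : ℂ)
    rw [← Complex.exp_eq_exp_ℂ, ← Complex.ofReal_exp, ← Complex.ofReal_mul, ← Real.exp_add,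
      neg_add_cancel, Real.exp_zero, Complex.ofReal_one] at h
    refine h.congr_fun fun k => ?_
    have hexp : Real.exp (-‖γ‖ ^ 2 / 2) * Real.exp (-‖γ‖ ^ 2 / 2) = Real.exp (-‖γ‖ ^ 2) := by
      rw [← Real.exp_add]; congr 1; ring
    have hfac : √(k ! : ℝ) * √(k ! : ℝ) = k ! := Real.mul_self_sqrt (by positivity)
    have hfac' : (k ! : ℂ) = (√(k ! : ℝ) : ℂ) * (√(k ! : ℝ) : ℂ) := by
      rw [← Complex.ofReal_mul, hfac, Complex.ofReal_natCast]
    have hnorm : ((‖γ‖ ^ 2 : ℝ) : ℂ) = γ * star γ := by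
      rw [Complex.star_def, Complex.mul_conj, Complex.normSq_eq_norm_sq]
    simp only [Function.comp_apply, e]
    rw [coherentAmplitude_probe, ← hexp, hfac', hnorm, Complex.ofReal_mul]
    simp only [star_mul', star_div₀, star_pow, Complex.star_def, Complex.conj_ofReal, mul_pow]
    ring
  · intro y hy
    have : ∃ j, y (Sum.inr j) ≠ 0 := by
      by_contra hcon
      push Not at hcon
      refine hy ⟨y (Sum.inl ()), ?_⟩
      funext k
      rcases k with k | k
      · rfl
      · simp [e, hcon]
    obtain ⟨j, hj⟩ := this
    rw [coherentAmplitude_probe_eq_zero γ hj, zero_mul]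

theorem hasSum_mul_prod {α β : Type*} {f : α → ℂ} {g : β → ℂ} {a b : ℂ} (hf : HasSum f a)
    (hg : HasSum g b) : HasSum (fun x : α × β => f x.1 * g x.2) (a * b) :=
  hf.mul hg (summable_mul_of_summable_norm (summable_norm_iff.mpr hf.summable)
    (summable_norm_iff.mpr hg.summable))

theorem hasSum_jointInput_diag {ρ : Matrix (PathModes s → ℕ) (PathModes s → ℕ) ℂ}
    (hρ : IsState ρ) (γ : ℂ) :
    HasSum (fun p : AllModes s → ℕ => jointInput γ ρ p p) 1 := by
  have h1 := hρ.trace_eq_one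
  have h2 := hasSum_coherentAmplitude_probe (s := s) γ
  have h := hasSum_mul_prod h1 h2
  rw [mul_one] at h
  have h4 := ((Equiv.sumArrowEquivProdArrow (PathModes s) (PathModes s) ℕ).hasSum_iff).mpr h
  refine h4.congr_fun fun p => ?_
  rfl

/-- The output of the beam splitter is normalized. -/
theorem hasSum_evolve_diag {ρ : Matrix (PathModes s → ℕ) (PathModes s → ℕ) ℂ}
    (hρ : IsState ρ) {η ζ : ℝ} (h : η ^ 2 + ζ ^ 2 = 1) (γ : ℂ) :
    HasSum (fun m => (evolve (beamSplitter s η ζ) (jointInput γ ρ) m m).re) 1 := by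
  refine hasSum_of_sum_piAntidiag_eq (f := fun p => (jointInput γ ρ p p).re) ?_ ?_ ?_ ?_
  · simpa using Complex.hasSum_re (hasSum_jointInput_diag hρ γ)
  · intro p
    refine (Complex.nonneg_iff.mp ?_).1
    exact mul_nonneg hρ.posSemidef.diag_nonneg (mul_star_self_nonneg _)
  · exact fun m => (Complex.nonneg_iff.mp (evolve_jointInput_diag_nonneg hρ.posSemidef _ γ m)).1
  · intro M
    rw [← Complex.re_sum, ← Complex.re_sum, sum_evolve_diag (conjTranspose_beamSplitter_mul h)]

variable {ρ : Matrix (PathModes s → ℕ) (PathModes s → ℕ) ℂ} {η ζ : ℝ}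

theorem sum_clickProb (hρ : IsState ρ) (h : η ^ 2 + ζ ^ 2 = 1) (γ : ℂ) :
    ∑ c, clickProb η ζ γ ρ c = 1 := by
  classical
  have h1 := (hasSum_evolve_diag hρ h γ).tsum_fiberwise
    fun m : AllModes s → ℕ => ((decide (∃ i, m (Sum.inl i) ≠ 0) : Bool),
      (decide (∃ i, m (Sum.inr i) ≠ 0) : Bool))
  rw [← (hasSum_fintype _).unique h1]
  refine Finset.sum_congr rfl fun c _ => ?_
  have : clickEvent s c = (fun m : AllModes s → ℕ => ((decide (∃ i, m (Sum.inl i) ≠ 0) : Bool),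
      (decide (∃ i, m (Sum.inr i) ≠ 0) : Bool))) ⁻¹' {c} := by
    ext m
    obtain ⟨c1, c2⟩ := c
    simp only [clickEvent, Set.mem_ofPred_eq, Set.mem_preimage, Set.mem_singleton_iff,
      Prod.mk.injEq]
    cases c1 <;> cases c2 <;> simp
  rw [clickProb, this]

theorem clickEvent_false_false : clickEvent s (false, false) = {0} := by
  ext m
  simp only [clickEvent, Set.mem_ofPred_eq, Set.mem_singleton_iff, Bool.false_eq_true, false_iff,
    not_exists, not_not]
  constructor
  · rintro ⟨h1, h2⟩
    funext i
    rcases i with i | i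
    · exact h1 i
    · exact h2 i
  · rintro rfl
    simp

theorem clickProb_false_false (γ : ℂ) :
    clickProb η ζ γ ρ (false, false) = Real.exp (-‖γ‖ ^ 2) * (ρ 0 0).re := by
  have h0 : (0 : AllModes s → ℕ) = onPath Sum.inl (Sum.elim (fun _ => 0) 0) := by
    funext j
    by_cases hj : j ∈ Set.range (Sum.inl : PathModes s → AllModes s)
    · obtain ⟨k, rfl⟩ := hj
      rw [onPath_apply Sum.inl_injective]
      rcases k with k | k <;> rfl
    · rw [onPath_apply_of_notMem hj]; rfl
  have h00 : (Sum.elim (fun _ => 0) 0 : PathModes s → ℕ) = 0 := by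
    funext k
    rcases k with k | k <;> rfl
  rw [clickProb, clickEvent_false_false, tsum_singleton (0 : AllModes s → ℕ)
    (fun m => (evolve (beamSplitter s η ζ) (jointInput γ ρ) m m).re), h0,
    evolve_onPath (isOutputPath_inl η ζ)]
  simp only [zero_add, Finset.range_one, Finset.sum_singleton, transferAmplitude, h00]
  have : Real.exp (-‖γ‖ ^ 2 / 2) * Real.exp (-‖γ‖ ^ 2 / 2) = Real.exp (-‖γ‖ ^ 2) := by
    rw [← Real.exp_add]; congr 1; ring
  rw [← this]
  simp [-Complex.ofReal_exp, Complex.conj_ofReal, ← Complex.ofReal_mul]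

theorem mem_range_onPath_inr (m : AllModes s → ℕ) :
    m ∈ Set.range (onPath (Sum.inr : PathModes s → AllModes s)) ↔ ∀ i, m (Sum.inl i) = 0 := by
  constructor
  · rintro ⟨x, rfl⟩ i
    exact onPath_apply_of_notMem (by simp)
  · intro h
    refine ⟨fun k => m (Sum.inr k), ?_⟩
    funext j
    rcases j with j | j
    · rw [onPath_apply_of_notMem (by simp), h]
    · rw [onPath_apply Sum.inr_injective]

theorem mem_range_onPath_inl (m : AllModes s → ℕ) :
    m ∈ Set.range (onPath (Sum.inl : PathModes s → AllModes s)) ↔ ∀ i, m (Sum.inr i) = 0 := by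
  constructor
  · rintro ⟨x, rfl⟩ i
    exact onPath_apply_of_notMem (by simp)
  · intro h
    refine ⟨fun k => m (Sum.inl k), ?_⟩
    funext j
    rcases j with j | j
    · rw [onPath_apply Sum.inl_injective]
    · rw [onPath_apply_of_notMem (by simp), h]

theorem clickProb_add_of_eq_range (hρ : IsState ρ) (h : η ^ 2 + ζ ^ 2 = 1) (γ : ℂ)
    {f : PathModes s → AllModes s} (hf : Function.Injective f) {c c' : Bool × Bool} (hc : c ≠ c')
    (hr : clickEvent s c ∪ clickEvent s c' = Set.range (onPath f)) :
    clickProb η ζ γ ρ c + clickProb η ζ γ ρ c'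
      = ∑' x, (evolve (beamSplitter s η ζ) (jointInput γ ρ) (onPath f x) (onPath f x)).re := by
  have hs := (hasSum_evolve_diag hρ h γ).summable
  rw [← tsum_range (fun m => (evolve (beamSplitter s η ζ) (jointInput γ ρ) m m).re)
    (onPath_injective hf), ← hr]
  symm
  refine Summable.tsum_union_disjoint ?_ (hs.subtype _) (hs.subtype _)
  rw [Set.disjoint_left]
  intro m h1 h2
  refine hc (Prod.ext ?_ ?_)
  · exact Bool.eq_iff_iff.mpr (h1.1.trans h2.1.symm)
  · exact Bool.eq_iff_iff.mpr (h1.2.trans h2.2.symm)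

/-- The probability of no click at detector 1. -/
theorem clickProb_dark_one (hρ : IsState ρ) (h : η ^ 2 + ζ ^ 2 = 1) (γ : ℂ) :
    clickProb η ζ γ ρ (false, false) + clickProb η ζ γ ρ (false, true)
      = ∑' x, (evolve (beamSplitter s η ζ) (jointInput γ ρ) (onPath Sum.inr x)
          (onPath Sum.inr x)).re := by
  refine clickProb_add_of_eq_range hρ h γ Sum.inr_injective (by simp) ?_
  ext m
  rw [mem_range_onPath_inr]
  simp only [clickEvent, Set.mem_union, Set.mem_ofPred_eq, Bool.false_eq_true, false_iff,
    not_exists, not_not, true_iff]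
  rw [← and_or_left, and_iff_left]
  exact (em _).imp id not_forall.mp

/-- The probability of no click at detector 2. -/
theorem clickProb_dark_two (hρ : IsState ρ) (h : η ^ 2 + ζ ^ 2 = 1) (γ : ℂ) :
    clickProb η ζ γ ρ (false, false) + clickProb η ζ γ ρ (true, false)
      = ∑' x, (evolve (beamSplitter s η ζ) (jointInput γ ρ) (onPath Sum.inl x)
          (onPath Sum.inl x)).re := by
  refine clickProb_add_of_eq_range hρ h γ Sum.inl_injective (by simp) ?_
  ext m
  rw [mem_range_onPath_inl]
  simp only [clickEvent, Set.mem_union, Set.mem_ofPred_eq, Bool.false_eq_true, false_iff,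
    not_exists, not_not, true_iff]
  rw [← or_and_right, and_iff_right]
  exact (em _).imp id not_forall.mp

/-- The operator `∑ n ≤ N, u^(2n) χ_n` of the matched mode: a photon outside the matched mode enters
the path that receives it with amplitude `u` with probability `u^2`. -/
def weightedConditional (u : ℝ) (N : ℕ) (ρ : Matrix (PathModes s → ℕ) (PathModes s → ℕ) ℂ) :
    Matrix ℕ ℕ ℂ := fun i j =>
  ∑ n ∈ Finset.range (N + 1), ((u : ℂ) ^ 2) ^ n * conditional ρ n i j

theorem AtMostPhotons.apply_eq_zero {N : ℕ} (hN : AtMostPhotons N ρ) {i j : ℕ} {r : Fin s → ℕ}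
    (h : N < i + ∑ l, r l ∨ N < j + ∑ l, r l) :
    ρ (Sum.elim (fun _ => i) r) (Sum.elim (fun _ => j) r) = 0 :=
  hN _ _ (by simpa [sum_pathModes] using h)

theorem hasSum_weightedConditional {N : ℕ} (hN : AtMostPhotons N ρ) (u : ℝ) (i j : ℕ) :
    HasSum (fun r : Fin s → ℕ => ((u : ℂ) ^ 2) ^ (∑ l, r l) *
      ρ (Sum.elim (fun _ => i) r) (Sum.elim (fun _ => j) r)) (weightedConditional u N ρ i j) := by
  have hdisj : Set.PairwiseDisjoint (Finset.range (N + 1) : Set ℕ)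
      fun n => Finset.piAntidiag (Finset.univ : Finset (Fin s)) n :=
    pairwiseDisjoint_piAntidiag _
  have hB : weightedConditional u N ρ i j = ∑ r ∈ (Finset.range (N + 1)).biUnion
      fun n => Finset.piAntidiag (Finset.univ : Finset (Fin s)) n, ((u : ℂ) ^ 2) ^ (∑ l, r l) *
      ρ (Sum.elim (fun _ => i) r) (Sum.elim (fun _ => j) r) := by
    rw [Finset.sum_biUnion hdisj, weightedConditional]
    refine Finset.sum_congr rfl fun n _ => ?_
    rw [conditional, Finset.mul_sum]
    refine Finset.sum_congr rfl fun r hr => ?_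
    rw [(Finset.mem_piAntidiag.mp hr).1]
  rw [hB]
  refine hasSum_sum_of_ne_finset_zero fun r hr => ?_
  rw [hN.apply_eq_zero, mul_zero]
  by_contra hcon
  refine hr (Finset.mem_biUnion.mpr ⟨∑ l, r l, ?_, Finset.mem_piAntidiag.mpr ⟨rfl, by simp⟩⟩)
  rw [Finset.mem_range]
  omega

theorem sum_range_eq_sum_range {f : ℕ → ℂ} {a b : ℕ} (ha : ∀ i, a ≤ i → f i = 0)
    (hb : ∀ i, b ≤ i → f i = 0) : ∑ i ∈ Finset.range a, f i = ∑ i ∈ Finset.range b, f i := by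
  rcases le_total a b with h | h
  · exact Finset.sum_subset (Finset.range_mono h) fun i _ hi => ha i (by simpa using hi)
  · exact (Finset.sum_subset (Finset.range_mono h) fun i _ hi => hb i (by simpa using hi)).symm

theorem transferAmplitude_eq_zero {u v : ℝ} {γ : ℂ} {M i : ℕ} (h : M < i) :
    transferAmplitude u v γ M i = 0 := by
  simp [transferAmplitude, Nat.choose_eq_zero_of_lt h]

/-- The probability that one path is dark depends on the state only through the operator
`∑ n, u^(2n) χ_n`. -/
theorem hasSum_darkProb {N : ℕ} (hρ : IsState ρ) (hN : AtMostPhotons N ρ)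
    (h : η ^ 2 + ζ ^ 2 = 1) (γ : ℂ) {f : PathModes s → AllModes s} {u v : ℝ}
    (hA : IsOutputPath (beamSplitter s η ζ) f u v) :
    HasSum (fun M => ∑ i ∈ Finset.range (N + 1), ∑ j ∈ Finset.range (N + 1),
        transferAmplitude u v γ M i * star (transferAmplitude u v γ M j) *
          weightedConditional u N ρ i j)
      ((∑' x, (evolve (beamSplitter s η ζ) (jointInput γ ρ) (onPath f x) (onPath f x)).re : ℝ)
        : ℂ) := by
  let e : ℕ × (Fin s → ℕ) ≃ (PathModes s → ℕ) :=
    { toFun := fun x => Sum.elim (fun _ => x.1) x.2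
      invFun := fun y => (y (Sum.inl ()), fun k => y (Sum.inr k))
      left_inv := fun x => rfl
      right_inv := fun y => by
        funext k
        rcases k with k | k <;> rfl }
  have h1 : HasSum (fun x => evolve (beamSplitter s η ζ) (jointInput γ ρ) (onPath f x)
      (onPath f x)) ((∑' x, (evolve (beamSplitter s η ζ) (jointInput γ ρ) (onPath f x)
        (onPath f x)).re : ℝ) : ℂ) := by
    have h2 := ((hasSum_evolve_diag hρ h γ).summable.comp_injective
      (onPath_injective hA.injective)).hasSum
    have h3 := Complex.hasSum_ofReal.mpr h2
    refine h3.congr_fun fun x => ?_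
    have := Complex.le_def.mp (evolve_jointInput_diag_nonneg hρ.posSemidef
      (beamSplitter s η ζ) γ (onPath f x))
    exact Complex.ext rfl this.2.symm
  rw [← e.hasSum_iff] at h1
  refine h1.prod_fiberwise fun M => ?_
  have h2 : ∀ r : Fin s → ℕ, ((fun x => evolve (beamSplitter s η ζ) (jointInput γ ρ) (onPath f x)
      (onPath f x)) ∘ e) (M, r) = ∑ i ∈ Finset.range (N + 1), ∑ j ∈ Finset.range (N + 1),
        transferAmplitude u v γ M i * star (transferAmplitude u v γ M j) *
          (((u : ℂ) ^ 2) ^ (∑ l, r l) *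
            ρ (Sum.elim (fun _ => i) r) (Sum.elim (fun _ => j) r)) := fun r => by
    refine (evolve_onPath hA γ ρ M r).trans ?_
    rw [sum_range_eq_sum_range (b := N + 1)]
    · refine Finset.sum_congr rfl fun i _ => sum_range_eq_sum_range ?_ ?_
      · intro j hj
        rw [transferAmplitude_eq_zero (i := j) (by omega)]
        simp
      · intro j hj
        rw [hN.apply_eq_zero (by omega)]
        simp
    · intro i hi
      simp [transferAmplitude_eq_zero (i := i) (M := M) (by omega)]
    · intro i hi
      refine Finset.sum_eq_zero fun j _ => ?_
      rw [hN.apply_eq_zero (by omega)]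
      simp
  simp only [h2]
  exact hasSum_sum fun i _ => hasSum_sum fun j _ =>
    (hasSum_weightedConditional hN u i j).mul_left _

end Probabilities

/-! ### The dark-path probabilities determine the weighted operator -/

section Injectivity

/-- Up to the factor `i! j!`, the terms are those of the derivative `∂_w^i ∂_v^j` of the exponential
series of `w v`. -/
theorem hasSum_choose_mul_choose (w v : ℂ) (i j : ℕ) :
    HasSum (fun M : ℕ => (M.choose i : ℂ) * M.choose j / M ! * w ^ (M - i) * v ^ (M - j))
      (Complex.exp (w * v) / i ! * ∑ x ∈ Finset.HasAntidiagonal.antidiagonal j,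
        (i.choose x.2 : ℂ) / x.1 ! * w ^ x.1 * v ^ (i - x.2)) := by
  have hi : Function.Injective fun k : ℕ => k + i := add_left_injective i
  rw [← hi.hasSum_iff]
  · have hterm : ∀ k : ℕ, ((fun M : ℕ => (M.choose i : ℂ) * M.choose j / M ! * w ^ (M - i) *
        v ^ (M - j)) ∘ fun k : ℕ => k + i) k = ∑ x ∈ Finset.HasAntidiagonal.antidiagonal j,
          (k.choose x.1 : ℂ) / k ! * (i.choose x.2) / i ! * w ^ k * v ^ (k + i - j) := by
      intro k
      simp only [Function.comp_apply]
      have hk : (k ! : ℂ) ≠ 0 := by exact_mod_cast Nat.factorial_ne_zero k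
      have hi' : (i ! : ℂ) ≠ 0 := by exact_mod_cast Nat.factorial_ne_zero i
      have hki : ((k + i)! : ℂ) ≠ 0 := by exact_mod_cast Nat.factorial_ne_zero _
      have h1 : ((k + i).choose i : ℂ) / (k + i)! = 1 / (k ! * i !) := by
        rw [div_eq_div_iff hki (mul_ne_zero hk hi'), one_mul, ← mul_assoc]
        have := Nat.add_choose_mul_factorial_mul_factorial k i
        rw [← Nat.choose_symm_add] at *
        exact_mod_cast this
      rw [mul_div_right_comm, h1, Nat.add_choose_eq, Nat.add_sub_cancel]
      push_cast
      rw [Finset.mul_sum, Finset.sum_mul, Finset.sum_mul]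
      refine Finset.sum_congr rfl fun x _ => ?_
      field_simp
    refine HasSum.congr_fun ?_ hterm
    rw [Finset.mul_sum]
    refine hasSum_sum fun x hx => ?_
    obtain ⟨a, t⟩ := x
    have hat : a + t = j := by simpa using hx
    subst hat
    simp only
    by_cases ht : i < t
    · simp [Nat.choose_eq_zero_of_lt ht, hasSum_zero]
    push Not at ht
    have ha : Function.Injective fun n : ℕ => n + a := add_left_injective a
    rw [← ha.hasSum_iff]
    · have hexp := (NormedSpace.expSeries_div_hasSum_exp (w * v)).mul_left
        ((i.choose t : ℂ) / (a ! * i !) * w ^ a * v ^ (i - t))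
      rw [← Complex.exp_eq_exp_ℂ] at hexp
      have hval : Complex.exp (w * v) / i ! * ((i.choose t : ℂ) / a ! * w ^ a * v ^ (i - t))
          = (i.choose t : ℂ) / (a ! * i !) * w ^ a * v ^ (i - t) * Complex.exp (w * v) := by
        field_simp
      rw [hval]
      refine hexp.congr_fun fun n => ?_
      simp only [Function.comp_apply]
      have hn : (n ! : ℂ) ≠ 0 := by exact_mod_cast Nat.factorial_ne_zero n
      have ha' : (a ! : ℂ) ≠ 0 := by exact_mod_cast Nat.factorial_ne_zero a
      have hna : ((n + a)! : ℂ) ≠ 0 := by exact_mod_cast Nat.factorial_ne_zero _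
      have h1 : ((n + a).choose a : ℂ) / (n + a)! = 1 / (n ! * a !) := by
        rw [div_eq_div_iff hna (mul_ne_zero hn ha'), one_mul, ← mul_assoc]
        have := Nat.add_choose_mul_factorial_mul_factorial n a
        rw [← Nat.choose_symm_add] at *
        exact_mod_cast this
      have h2 : n + a + i - (a + t) = n + (i - t) := by omega
      rw [h1, h2, pow_add, pow_add, mul_pow]
      field_simp
    · intro k hk
      have : k < a := by
        by_contra hcon
        exact hk ⟨k - a, by simp only; omega⟩
      simp [Nat.choose_eq_zero_of_lt this]
  · intro M hM
    have : M < i := by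
      by_contra hcon
      exact hM ⟨M - i, by simp only; omega⟩
    simp [Nat.choose_eq_zero_of_lt this]

theorem infinite_unit_circle : {u : ℂ | ‖u‖ = 1}.Infinite := by
  have h := isPreconnected_sphere (E := ℂ) (by rw [Complex.rank_real_complex]; norm_num) 0 1
  have h2 : {u : ℂ | ‖u‖ = 1} = Metric.sphere 0 1 := by ext u; simp
  rw [h2]
  refine h.infinite_of_nontrivial ⟨1, by simp, -1, by simp, ?_⟩
  norm_num

/-- A polynomial in `w` and its conjugate that vanishes identically has zero coefficients. -/
theorem coeff_eq_zero_of_forall_conj {K : ℕ} {c : ℕ → ℕ → ℂ}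
    (h : ∀ w : ℂ, ∑ a ∈ Finset.range K, ∑ b ∈ Finset.range K, c a b * (w ^ a * star w ^ b) = 0)
    {a b : ℕ} (ha : a < K) (hb : b < K) : c a b = 0 := by
  -- the part of total degree `n` vanishes on the unit circle
  have h1 : ∀ (n : ℕ) (u : ℂ), ∑ a ∈ Finset.range K, ∑ b ∈ Finset.range K,
      (if a + b = n then c a b * (u ^ a * star u ^ b) else 0) = 0 := by
    intro n u
    let P : Polynomial ℂ := ∑ a ∈ Finset.range K, ∑ b ∈ Finset.range K,
      Polynomial.monomial (a + b) (c a b * (u ^ a * star u ^ b))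
    have hP : P = 0 := by
      refine Polynomial.eq_zero_of_infinite_isRoot P (Set.Infinite.mono (s := Set.range
        (fun r : ℝ => (r : ℂ))) ?_ (Set.infinite_range_of_injective Complex.ofReal_injective))
      rintro _ ⟨r, rfl⟩
      have hr := h (r * u)
      simp only [star_mul', Complex.star_def, Complex.conj_ofReal, mul_pow] at hr
      simp only [Set.mem_ofPred_eq, Polynomial.IsRoot, P, Polynomial.eval_finsetSum,
        Polynomial.eval_monomial, Complex.star_def]
      rw [← hr]
      refine Finset.sum_congr rfl fun a _ => Finset.sum_congr rfl fun b _ => ?_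
      ring
    have hc := congrArg (fun Q : Polynomial ℂ => Q.coeff n) hP
    simpa [P, Polynomial.finsetSum_coeff, Polynomial.coeff_monomial] using hc
  let Q : Polynomial ℂ := ∑ a' ∈ Finset.range K, ∑ b' ∈ Finset.range K,
    if a' + b' = a + b then Polynomial.monomial (2 * a') (c a' b') else 0
  have hQ : Q = 0 := by
    refine Polynomial.eq_zero_of_infinite_isRoot Q (infinite_unit_circle.mono fun u hu => ?_)
    have huu : u * star u = 1 := by
      rw [Complex.star_def, Complex.mul_conj, Complex.normSq_eq_norm_sq, Set.mem_ofPred_eq.mp hu]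
      simp
    have hn := congrArg (fun z => z * u ^ (a + b)) (h1 (a + b) u)
    simp only [zero_mul, Finset.sum_mul] at hn
    simp only [Set.mem_ofPred_eq, Polynomial.IsRoot, Q, Polynomial.eval_finsetSum]
    rw [← hn]
    refine Finset.sum_congr rfl fun a' _ => Finset.sum_congr rfl fun b' _ => ?_
    split_ifs with hab
    · rw [Polynomial.eval_monomial, ← hab, pow_add, two_mul, pow_add]
      have : star u ^ b' * u ^ b' = 1 := by rw [← mul_pow, mul_comm, huu, one_pow]
      linear_combination (-(c a' b') * u ^ a' * u ^ a') * this
    · simp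
  have hc := congrArg (fun R : Polynomial ℂ => R.coeff (2 * a)) hQ
  simp only [Q, Polynomial.finsetSum_coeff, Polynomial.coeff_zero] at hc
  rw [Finset.sum_eq_single a, Finset.sum_eq_single b] at hc
  · simpa using hc
  · intro b' _ hb'
    rw [if_neg (by omega), Polynomial.coeff_zero]
  · intro hb'
    exact absurd (Finset.mem_range.mpr hb) hb'
  · intro a' _ ha'
    refine Finset.sum_eq_zero fun b' _ => ?_
    split_ifs
    · rw [Polynomial.coeff_monomial, if_neg (by omega)]
    · simp
  · intro ha'
    exact absurd (Finset.mem_range.mpr ha) ha'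

theorem sum_range_sum_antidiagonal {K : ℕ} (g : ℕ × ℕ → ℂ)
    (hg : ∀ x : ℕ × ℕ, K ≤ x.1 + x.2 → g x = 0) :
    ∑ j ∈ Finset.range K, ∑ x ∈ Finset.HasAntidiagonal.antidiagonal j, g x
      = ∑ a ∈ Finset.range K, ∑ t ∈ Finset.range K, g (a, t) := by
  rw [← Finset.sum_product', Finset.sum_sigma']
  refine Finset.sum_of_injOn (fun y => y.2) ?_ ?_ ?_ (fun _ _ => rfl)
  · rintro ⟨j, x⟩ hx ⟨j', x'⟩ hx' heq
    simp only [Finset.mem_coe, Finset.mem_sigma, Finset.HasAntidiagonal.mem_antidiagonal]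
      at hx hx' heq
    subst heq
    obtain rfl : j = j' := hx.2.symm.trans hx'.2
    rfl
  · rintro ⟨j, x⟩ hx
    simp only [Finset.mem_coe, Finset.mem_sigma, Finset.HasAntidiagonal.mem_antidiagonal,
      Finset.mem_range, Finset.mem_product] at hx ⊢
    omega
  · intro x _ hx
    refine hg x (not_lt.mp fun hlt => hx ⟨⟨x.1 + x.2, x⟩, ?_, rfl⟩)
    simpa using hlt

theorem sum_range_shift {K t : ℕ} {f : ℕ → ℂ} (h1 : ∀ i < t, f i = 0) (h2 : ∀ i, K ≤ i → f i = 0) :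
    ∑ i ∈ Finset.range K, f i = ∑ b ∈ Finset.range K, f (b + t) := by
  rw [sum_range_eq_sum_range (b := t + K) h2 fun i hi => h2 i (by omega), Finset.sum_range_add,
    Finset.sum_eq_zero fun i hi => h1 i (Finset.mem_range.mp hi), zero_add]
  exact Finset.sum_congr rfl fun b _ => by rw [add_comm]

/-- The polynomials `∑ C(i, t) / a! * w^a v^(i-t)`, over `a + t = j`, have pairwise different
leading terms, so that they are linearly independent. -/
theorem eq_zero_of_sum_antidiagonal {K : ℕ} {D : ℕ → ℕ → ℂ}
    (hD : ∀ i j, K ≤ i ∨ K ≤ j → D i j = 0)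
    (h : ∀ w : ℂ, ∑ i ∈ Finset.range K, ∑ j ∈ Finset.range K, D i j *
      ∑ x ∈ Finset.HasAntidiagonal.antidiagonal j,
        (i.choose x.2 : ℂ) / x.1 ! * w ^ x.1 * star w ^ (i - x.2) = 0)
    (i j : ℕ) : D i j = 0 := by
  let c : ℕ → ℕ → ℂ := fun a b =>
    ∑ t ∈ Finset.range K, D (b + t) (a + t) * ((b + t).choose t : ℂ) / (a !)
  have hc : ∀ a < K, ∀ b < K, c a b = 0 := by
    refine fun a ha b hb => coeff_eq_zero_of_forall_conj (K := K) (fun w => ?_) ha hb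
    rw [← h w]
    symm
    calc ∑ i ∈ Finset.range K, ∑ j ∈ Finset.range K, D i j *
          ∑ x ∈ Finset.HasAntidiagonal.antidiagonal j,
          (i.choose x.2 : ℂ) / x.1 ! * w ^ x.1 * star w ^ (i - x.2)
        = ∑ i ∈ Finset.range K, ∑ j ∈ Finset.range K, ∑ x ∈ Finset.HasAntidiagonal.antidiagonal j,
          D i (x.1 + x.2) *
            ((i.choose x.2 : ℂ) / x.1 ! * w ^ x.1 * star w ^ (i - x.2)) := by
          refine Finset.sum_congr rfl fun i _ => Finset.sum_congr rfl fun j _ => ?_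
          rw [Finset.mul_sum]
          refine Finset.sum_congr rfl fun x hx => ?_
          rw [Finset.HasAntidiagonal.mem_antidiagonal.mp hx]
      _ = ∑ i ∈ Finset.range K, ∑ a ∈ Finset.range K, ∑ t ∈ Finset.range K, D i (a + t) *
            ((i.choose t : ℂ) / a ! * w ^ a * star w ^ (i - t)) := by
          refine Finset.sum_congr rfl fun i _ => ?_
          exact sum_range_sum_antidiagonal (fun x => D i (x.1 + x.2) *
            ((i.choose x.2 : ℂ) / x.1 ! * w ^ x.1 * star w ^ (i - x.2)))
            fun x hx => by rw [hD _ _ (Or.inr hx), zero_mul]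
      _ = ∑ a ∈ Finset.range K, ∑ t ∈ Finset.range K, ∑ i ∈ Finset.range K, D i (a + t) *
            ((i.choose t : ℂ) / a ! * w ^ a * star w ^ (i - t)) := by
          rw [Finset.sum_comm]
          exact Finset.sum_congr rfl fun a _ => Finset.sum_comm
      _ = ∑ a ∈ Finset.range K, ∑ t ∈ Finset.range K, ∑ b ∈ Finset.range K, D (b + t) (a + t) *
            (((b + t).choose t : ℂ) / a ! * w ^ a * star w ^ (b + t - t)) := by
          refine Finset.sum_congr rfl fun a _ => Finset.sum_congr rfl fun t _ => ?_
          refine sum_range_shift (fun i hi => ?_) (fun i hi => ?_)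
          · simp [Nat.choose_eq_zero_of_lt hi]
          · rw [hD _ _ (Or.inl hi), zero_mul]
      _ = ∑ a ∈ Finset.range K, ∑ b ∈ Finset.range K, c a b * (w ^ a * star w ^ b) := by
          refine Finset.sum_congr rfl fun a _ => ?_
          rw [Finset.sum_comm]
          refine Finset.sum_congr rfl fun b _ => ?_
          rw [Finset.sum_mul]
          refine Finset.sum_congr rfl fun t _ => ?_
          rw [Nat.add_sub_cancel]
          ring
  -- descending induction on `i + j`: the leading coefficients vanish first
  have hind : ∀ n i j, 2 * K ≤ i + j + n → D i j = 0 := by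
    intro n
    induction n with
    | zero => intro i j hij; exact hD i j (by omega)
    | succ n ih =>
      intro i j hij
      by_cases hK : K ≤ i ∨ K ≤ j
      · exact hD i j hK
      push Not at hK
      have hji := hc j hK.2 i hK.1
      simp only [c] at hji
      rw [Finset.sum_eq_single 0] at hji
      · have hj : (j ! : ℂ) ≠ 0 := by exact_mod_cast Nat.factorial_ne_zero j
        simpa [hj] using hji
      · intro t _ ht
        rw [ih (i + t) (j + t) (by omega), zero_mul, zero_div]
      · intro h0
        exact absurd (Finset.mem_range.mpr (by omega)) h0
  exact hind (2 * K) i j (by omega)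

theorem transferAmplitude_mul_star (u v : ℝ) (γ : ℂ) (M i j : ℕ) :
    transferAmplitude u v γ M i * star (transferAmplitude u v γ M j)
      = ((Real.exp (-‖γ‖ ^ 2) : ℝ) : ℂ) * ((√(i ! : ℝ) * √(j ! : ℝ) * u ^ i * u ^ j : ℝ) : ℂ) *
        ((M.choose i : ℂ) * M.choose j / M ! * ((v : ℂ) * γ) ^ (M - i) *
          star ((v : ℂ) * γ) ^ (M - j)) := by
  have hexp : Real.exp (-‖γ‖ ^ 2 / 2) * Real.exp (-‖γ‖ ^ 2 / 2) = Real.exp (-‖γ‖ ^ 2) := by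
    rw [← Real.exp_add]; congr 1; ring
  have hfac : (M ! : ℂ) = (√(M ! : ℝ) : ℂ) * (√(M ! : ℝ) : ℂ) := by
    rw [← Complex.ofReal_mul, Real.mul_self_sqrt (by positivity), Complex.ofReal_natCast]
  simp only [transferAmplitude, star_mul', star_pow, Complex.star_def, Complex.conj_ofReal]
  rw [← hexp, hfac]
  push_cast
  ring

variable {s : ℕ} {ρ σ : Matrix (PathModes s → ℕ) (PathModes s → ℕ) ℂ} {η ζ : ℝ}

theorem weightedConditional_eq_zero {N : ℕ} (hN : AtMostPhotons N ρ) (u : ℝ) {i j : ℕ}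
    (h : N < i ∨ N < j) : weightedConditional u N ρ i j = 0 := by
  refine Finset.sum_eq_zero fun n _ => mul_eq_zero_of_right _ (Finset.sum_eq_zero fun r _ => ?_)
  exact hN.apply_eq_zero (by omega)

/-- States with the same probabilities of a dark path, for all probe amplitudes, have the same
weighted operator, as these probabilities are polynomials in the probe amplitude and its conjugate,
up to a Gaussian factor. -/
theorem weightedConditional_eq_of_darkProb_eq {N : ℕ} (hρ : IsState ρ) (hσ : IsState σ)
    (hNρ : AtMostPhotons N ρ) (hNσ : AtMostPhotons N σ) (h : η ^ 2 + ζ ^ 2 = 1)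
    {f : PathModes s → AllModes s} {u v : ℝ} (hu : u ≠ 0) (hv : v ≠ 0)
    (hA : IsOutputPath (beamSplitter s η ζ) f u v)
    (heq : ∀ γ : ℂ,
      ∑' x, (evolve (beamSplitter s η ζ) (jointInput γ ρ) (onPath f x) (onPath f x)).re
        = ∑' x, (evolve (beamSplitter s η ζ) (jointInput γ σ) (onPath f x) (onPath f x)).re) :
    weightedConditional u N ρ = weightedConditional u N σ := by
  let Δ : ℕ → ℕ → ℂ := fun i j =>
    weightedConditional u N ρ i j - weightedConditional u N σ i j
  let κ : ℕ → ℕ → ℝ := fun i j => √(i ! : ℝ) * √(j ! : ℝ) * u ^ i * u ^ j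
  have hκ : ∀ i j, κ i j ≠ 0 := fun i j => by
    positivity
  have hzero : ∀ i j, (κ i j : ℂ) / i ! * Δ i j = 0 := by
    refine eq_zero_of_sum_antidiagonal (K := N + 1) ?_ ?_
    · intro i j hij
      have h' : N < i ∨ N < j := by omega
      simp [Δ, weightedConditional_eq_zero hNρ u h', weightedConditional_eq_zero hNσ u h']
    · intro w
      -- the probe amplitude that displaces by `w`
      let γ : ℂ := w / v
      have hw : (v : ℂ) * γ = w := mul_div_cancel₀ _ (by exact_mod_cast hv)
      have h1 := (hasSum_darkProb hρ hNρ h γ hA).sub (hasSum_darkProb hσ hNσ h γ hA)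
      rw [heq γ, sub_self] at h1
      have h2 : HasSum (fun M => ∑ i ∈ Finset.range (N + 1), ∑ j ∈ Finset.range (N + 1),
          transferAmplitude u v γ M i * star (transferAmplitude u v γ M j) * Δ i j)
          (∑ i ∈ Finset.range (N + 1), ∑ j ∈ Finset.range (N + 1),
            ((Real.exp (-‖γ‖ ^ 2) : ℝ) : ℂ) * (κ i j : ℂ) *
              (Complex.exp (w * star w) / i ! * ∑ x ∈ Finset.HasAntidiagonal.antidiagonal j,
                (i.choose x.2 : ℂ) / x.1 ! * w ^ x.1 * star w ^ (i - x.2)) * Δ i j) := by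
        refine hasSum_sum fun i _ => hasSum_sum fun j _ => HasSum.mul_right _ ?_
        simp only [transferAmplitude_mul_star, hw]
        exact (hasSum_choose_mul_choose w (star w) i j).mul_left _
      have h3 := h1.unique (h2.congr_fun fun M => by
        simp only [Δ, mul_sub, Finset.sum_sub_distrib])
      have hne : ((Real.exp (-‖γ‖ ^ 2) : ℝ) : ℂ) * Complex.exp (w * star w) ≠ 0 :=
        mul_ne_zero (by exact_mod_cast (Real.exp_pos _).ne') (Complex.exp_ne_zero _)
      refine (mul_eq_zero.mp (Eq.trans ?_ h3.symm)).resolve_left hne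
      rw [Finset.mul_sum]
      refine Finset.sum_congr rfl fun i _ => ?_
      rw [Finset.mul_sum]
      refine Finset.sum_congr rfl fun j _ => ?_
      ring
  ext i j
  have hij := hzero i j
  have hi : (i ! : ℂ) ≠ 0 := by exact_mod_cast Nat.factorial_ne_zero i
  have hk : (κ i j : ℂ) ≠ 0 := by exact_mod_cast hκ i j
  exact sub_eq_zero.mp ((mul_eq_zero.mp hij).resolve_left (div_ne_zero hk hi))

end Injectivity

/-! ### The information in the click statistics -/

section Statistics

variable {s : ℕ} {ρ σ : Matrix (PathModes s → ℕ) (PathModes s → ℕ) ℂ} {η ζ : ℝ}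

theorem conditional_zero_zero_zero (ρ : Matrix (PathModes s → ℕ) (PathModes s → ℕ) ℂ) :
    conditional ρ 0 0 0 = ρ 0 0 := by
  have h00 : (Sum.elim (fun _ => 0) 0 : PathModes s → ℕ) = 0 := by
    funext k
    rcases k with k | k <;> rfl
  simp [conditional, h00]

theorem conditional_eq_zero {N : ℕ} (hN : AtMostPhotons N ρ) {n i j : ℕ}
    (h : N < i + n ∨ N < j + n) : conditional ρ n i j = 0 :=
  Finset.sum_eq_zero fun r hr => hN.apply_eq_zero (by
    rwa [(Finset.mem_piAntidiag.mp hr).1])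

/-- The click statistics contain the operators `∑ n, ζ^(2n) χ_n` and `∑ n, η^(2n) χ_n` and the
vacuum probability. -/
theorem weightedConditional_eq_of_clickProb_eq {N : ℕ} (hρ : IsState ρ) (hσ : IsState σ)
    (hNρ : AtMostPhotons N ρ) (hNσ : AtMostPhotons N σ) (h : η ^ 2 + ζ ^ 2 = 1)
    (hη : η ≠ 0) (hζ : ζ ≠ 0)
    (heq : ∀ (γ : ℂ) (c : Bool × Bool), clickProb η ζ γ ρ c = clickProb η ζ γ σ c) :
    weightedConditional ζ N ρ = weightedConditional ζ N σ ∧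
      weightedConditional η N ρ = weightedConditional η N σ ∧ ρ 0 0 = σ 0 0 := by
  refine ⟨?_, ?_, ?_⟩
  · refine weightedConditional_eq_of_darkProb_eq hρ hσ hNρ hNσ h hζ (neg_ne_zero.mpr hη)
      (isOutputPath_inr η ζ) fun γ => ?_
    rw [← clickProb_dark_one hρ h, ← clickProb_dark_one hσ h, heq, heq]
  · refine weightedConditional_eq_of_darkProb_eq hρ hσ hNρ hNσ h hη hζ
      (isOutputPath_inl η ζ) fun γ => ?_
    rw [← clickProb_dark_two hρ h, ← clickProb_dark_two hσ h, heq, heq]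
  · have h0 := heq 0 (false, false)
    simp only [clickProb_false_false, norm_zero] at h0
    have hρ0 := Complex.nonneg_iff.mp (hρ.posSemidef.diag_nonneg (i := 0))
    have hσ0 := Complex.nonneg_iff.mp (hσ.posSemidef.diag_nonneg (i := 0))
    exact Complex.ext (by simpa using h0) (hρ0.2.symm.trans hσ0.2)

/-- The click statistics contain no more than the operators `∑ n, ζ^(2n) χ_n` and
`∑ n, η^(2n) χ_n` and the vacuum probability. -/
theorem clickProb_eq_of_weightedConditional_eq {N : ℕ} (hρ : IsState ρ) (hσ : IsState σ)
    (hNρ : AtMostPhotons N ρ) (hNσ : AtMostPhotons N σ) (h : η ^ 2 + ζ ^ 2 = 1)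
    (h1 : weightedConditional ζ N ρ = weightedConditional ζ N σ)
    (h2 : weightedConditional η N ρ = weightedConditional η N σ) (h0 : ρ 0 0 = σ 0 0)
    (γ : ℂ) (c : Bool × Bool) : clickProb η ζ γ ρ c = clickProb η ζ γ σ c := by
  have hFF : clickProb η ζ γ ρ (false, false) = clickProb η ζ γ σ (false, false) := by
    rw [clickProb_false_false, clickProb_false_false, h0]
  have hFT : clickProb η ζ γ ρ (false, true) = clickProb η ζ γ σ (false, true) := by
    have e1 := hasSum_darkProb hρ hNρ h γ (isOutputPath_inr η ζ)
    rw [h1] at e1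
    have e2 := e1.unique (hasSum_darkProb hσ hNσ h γ (isOutputPath_inr η ζ))
    rw [← clickProb_dark_one hρ h, ← clickProb_dark_one hσ h, hFF] at e2
    exact add_left_cancel (Complex.ofReal_injective e2)
  have hTF : clickProb η ζ γ ρ (true, false) = clickProb η ζ γ σ (true, false) := by
    have e1 := hasSum_darkProb hρ hNρ h γ (isOutputPath_inl η ζ)
    rw [h2] at e1
    have e2 := e1.unique (hasSum_darkProb hσ hNσ h γ (isOutputPath_inl η ζ))
    rw [← clickProb_dark_two hρ h, ← clickProb_dark_two hσ h, hFF] at e2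
    exact add_left_cancel (Complex.ofReal_injective e2)
  have hTT : clickProb η ζ γ ρ (true, true) = clickProb η ζ γ σ (true, true) := by
    have e := (sum_clickProb hρ h γ).trans (sum_clickProb hσ h γ).symm
    simp only [Fintype.sum_prod_type, Fintype.sum_bool] at e
    linarith
  rcases c with ⟨_ | _, _ | _⟩
  exacts [hFF, hFT, hTF, hTT]

theorem twirledTwoMode_apply (n i j : ℕ) :
    twirledTwoMode ρ (i, n) (j, n) = conditional ρ n i j := by
  simp [twirledTwoMode, conditional_twirl]

theorem twirledTwoMode_eq (h : ∀ n i j, conditional ρ n i j = conditional σ n i j) :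
    twirledTwoMode ρ = twirledTwoMode σ := by
  ext x y
  simp [twirledTwoMode, conditional_twirl, h]

theorem ClickStatisticsDetermine.mono {N N' : ℕ} (hN : N' ≤ N)
    (h : ClickStatisticsDetermine s η ζ N) : ClickStatisticsDetermine s η ζ N' :=
  fun ρ σ hρ hσ hNρ hNσ => h ρ σ hρ hσ (fun m n hmn => hNρ m n (by omega))
    (fun m n hmn => hNσ m n (by omega))

theorem clickStatisticsDetermine_one (h : η ^ 2 + ζ ^ 2 = 1) (hη : η ≠ 0) (hζ : ζ ≠ 0) :
    ClickStatisticsDetermine s η ζ 1 := by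
  intro ρ σ hρ hσ hNρ hNσ heq
  obtain ⟨h1, -, h0⟩ := weightedConditional_eq_of_clickProb_eq hρ hσ hNρ hNσ h hη hζ heq
  rw [← conditional_zero_zero_zero ρ, ← conditional_zero_zero_zero σ] at h0
  have hζ' : (ζ : ℂ) ^ 2 ≠ 0 := pow_ne_zero _ (by exact_mod_cast hζ)
  refine twirledTwoMode_eq fun n i j => ?_
  by_cases hout : 1 < i + n ∨ 1 < j + n
  · rw [conditional_eq_zero hNρ hout, conditional_eq_zero hNσ hout]
  have e := congrFun (congrFun h1 i) j
  simp only [weightedConditional, Finset.sum_range_succ, Finset.sum_range_zero, zero_add,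
    pow_zero, one_mul, pow_one] at e
  by_cases hij : i = 0 ∧ j = 0
  · obtain ⟨rfl, rfl⟩ := hij
    obtain rfl | rfl : n = 0 ∨ n = 1 := by omega
    · exact h0
    · rw [h0] at e
      exact mul_left_cancel₀ hζ' (add_left_cancel e)
  · obtain rfl : n = 0 := by omega
    rw [conditional_eq_zero hNρ (n := 1) (by omega), conditional_eq_zero hNσ (n := 1) (by omega)]
      at e
    simpa using e

theorem clickStatisticsDetermine_two (h : η ^ 2 + ζ ^ 2 = 1) (hη : η ≠ 0) (hζ : ζ ≠ 0)
    (hne : η ^ 2 ≠ ζ ^ 2) : ClickStatisticsDetermine s η ζ 2 := by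
  intro ρ σ hρ hσ hNρ hNσ heq
  obtain ⟨h1, h2, h0⟩ := weightedConditional_eq_of_clickProb_eq hρ hσ hNρ hNσ h hη hζ heq
  rw [← conditional_zero_zero_zero ρ, ← conditional_zero_zero_zero σ] at h0
  have hζ' : (ζ : ℂ) ^ 2 ≠ 0 := pow_ne_zero _ (by exact_mod_cast hζ)
  have hη' : (η : ℂ) ^ 2 ≠ 0 := pow_ne_zero _ (by exact_mod_cast hη)
  have hne' : (η : ℂ) ^ 2 - (ζ : ℂ) ^ 2 ≠ 0 := sub_ne_zero.mpr (by exact_mod_cast hne)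
  -- two linear equations with different weights determine two consecutive terms
  have hlin : ∀ x y x' y' : ℂ, x + (ζ : ℂ) ^ 2 * y = x' + (ζ : ℂ) ^ 2 * y' →
      x + (η : ℂ) ^ 2 * y = x' + (η : ℂ) ^ 2 * y' → x = x' ∧ y = y' := by
    intro x y x' y' e1 e2
    have hy : y = y' := mul_left_cancel₀ hne' (by linear_combination e2 - e1)
    exact ⟨by rw [hy] at e1; exact add_right_cancel e1, hy⟩
  refine twirledTwoMode_eq fun n i j => ?_
  by_cases hout : 2 < i + n ∨ 2 < j + n
  · rw [conditional_eq_zero hNρ hout, conditional_eq_zero hNσ hout]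
  have e1 := congrFun (congrFun h1 i) j
  have e2 := congrFun (congrFun h2 i) j
  simp only [weightedConditional, Finset.sum_range_succ, Finset.sum_range_zero, zero_add,
    pow_zero, one_mul, pow_one] at e1 e2
  by_cases hij : i = 0 ∧ j = 0
  · obtain ⟨rfl, rfl⟩ := hij
    obtain ⟨h3, h4⟩ := hlin (conditional ρ 1 0 0) (conditional ρ 2 0 0) (conditional σ 1 0 0)
      (conditional σ 2 0 0)
      (mul_left_cancel₀ hζ' (by linear_combination e1 - h0))
      (mul_left_cancel₀ hη' (by linear_combination e2 - h0))
    obtain rfl | rfl | rfl : n = 0 ∨ n = 1 ∨ n = 2 := by omega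
    exacts [h0, h3, h4]
  · rw [conditional_eq_zero hNρ (n := 2) (by omega), conditional_eq_zero hNσ (n := 2) (by omega),
      mul_zero, add_zero, add_zero] at e1 e2
    obtain ⟨h3, h4⟩ := hlin _ _ _ _ e1 e2
    obtain rfl | rfl : n = 0 ∨ n = 1 := by omega
    exacts [h3, h4]

end Statistics

/-! ### Indistinguishable states -/

section Counterexample

theorem posSemidef_rankOne {n : Type*} (ψ : n → ℂ) :
    (Matrix.of fun i j => ψ i * star (ψ j)).PosSemidef := by
  refine ⟨?_, fun x => ?_⟩
  · ext i j
    simp [Matrix.conjTranspose_apply, mul_comm]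
  · have : (x.sum fun i xi => x.sum fun j xj =>
        star xi * (Matrix.of fun i j => ψ i * star (ψ j)) i j * xj)
        = (∑ i ∈ x.support, star (x i) * ψ i) * star (∑ i ∈ x.support, star (x i) * ψ i) := by
      rw [star_sum, Finset.sum_mul_sum]
      refine Finset.sum_congr rfl fun i _ => Finset.sum_congr rfl fun j _ => ?_
      simp only [Matrix.of_apply, star_mul', star_star]
      ring
    rw [this]
    exact mul_star_self_nonneg _

variable {s : ℕ}

/-- The vector `|0, n⟩ + t |1, n⟩`, whose first entry counts the photons in the matched mode; the
other `n` photons are in the mode `k`. -/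
def superposition (k : Fin s) (n : ℕ) (t : ℝ) (m : PathModes s → ℕ) : ℂ :=
  if (fun l => m (Sum.inr l)) = Pi.single k n then
    (if m (Sum.inl ()) = 0 then 1 else if m (Sum.inl ()) = 1 then (t : ℂ) else 0) else 0

/-- The sign of `x`, with value `1` at `0`. -/
def unitSign (x : ℝ) : ℝ := if 0 ≤ x then 1 else -1

theorem abs_mul_unitSign (x : ℝ) : |x| * unitSign x = x := by
  unfold unitSign
  split_ifs with h
  · rw [abs_of_nonneg h, mul_one]
  · rw [abs_of_neg (not_le.mp h)]; ring

theorem unitSign_mul_self (x : ℝ) : unitSign x * unitSign x = 1 := by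
  unfold unitSign
  split_ifs <;> norm_num

/-- The mixture of the states `|0, n⟩ ± |1, n⟩`, over `n ≤ d`, with weights proportional to `|c n|`
and the signs of the `c n`.  The coherences of its `χ_n` are proportional to `c n`, and its diagonal
depends on the `|c n|` only. -/
def coherenceState (k : Fin s) (d : ℕ) (c : ℕ → ℝ) :
    Matrix (PathModes s → ℕ) (PathModes s → ℕ) ℂ :=
  ∑ n ∈ Finset.range (d + 1), (((|c n| / (2 * ∑ n ∈ Finset.range (d + 1), |c n|) : ℝ)) : ℂ) •
    Matrix.of fun m m' => superposition k n (unitSign (c n)) m *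
      star (superposition k n (unitSign (c n)) m')

theorem hasSum_superposition (k : Fin s) (n : ℕ) (x : ℝ) :
    HasSum (fun m => superposition k n (unitSign x) m *
      star (superposition k n (unitSign x) m)) 2 := by
  classical
  let e : ℕ → (PathModes s → ℕ) := fun i => Sum.elim (fun _ => i) (Pi.single k n)
  have he : e 0 ≠ e 1 := fun h => absurd (congrFun h (Sum.inl ())) (by simp [e])
  have h2 : (2 : ℂ) = ∑ m ∈ {e 0, e 1}, superposition k n (unitSign x) m *
      star (superposition k n (unitSign x) m) := by
    have := unitSign_mul_self x
    rw [Finset.sum_pair he]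
    simp only [superposition, e, Sum.elim_inl, Sum.elim_inr, if_true, one_ne_zero, if_false,
      star_one, mul_one, Complex.star_def, Complex.conj_ofReal, ← Complex.ofReal_mul, this]
    norm_num
  rw [h2]
  refine hasSum_sum_of_ne_finset_zero fun m hm => mul_eq_zero_of_left ?_ _
  rw [superposition]
  split_ifs with h3 h4 h5
  · refine absurd (Finset.mem_insert.mpr (Or.inl ?_)) hm
    funext l
    rcases l with l | l
    · exact h4
    · exact congrFun h3 l
  · refine absurd (Finset.mem_insert_of_mem (Finset.mem_singleton.mpr ?_)) hm
    funext l
    rcases l with l | l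
    · exact h5
    · exact congrFun h3 l
  · rfl
  · rfl

theorem isState_coherenceState (k : Fin s) (d : ℕ) {c : ℕ → ℝ} (hc : c d ≠ 0) :
    IsState (coherenceState k d c) where
  posSemidef := by
    refine Matrix.posSemidef_sum _ fun n _ => (posSemidef_rankOne _).smul ?_
    rw [Complex.zero_le_real]
    positivity
  trace_eq_one := by
    have hW : 0 < ∑ n ∈ Finset.range (d + 1), |c n| :=
      Finset.sum_pos' (fun n _ => abs_nonneg _) ⟨d, by simp, abs_pos.mpr hc⟩
    have h := hasSum_sum (s := Finset.range (d + 1)) fun n _ =>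
      (hasSum_superposition k n (c n)).mul_left
        (((|c n| / (2 * ∑ n ∈ Finset.range (d + 1), |c n|) : ℝ)) : ℂ)
    have h1 : ∑ n ∈ Finset.range (d + 1),
        (((|c n| / (2 * ∑ n ∈ Finset.range (d + 1), |c n|) : ℝ)) : ℂ) * 2 = 1 := by
      rw [← Finset.sum_mul, ← Complex.ofReal_sum, ← Finset.sum_div]
      have : (∑ n ∈ Finset.range (d + 1), |c n|) / (2 * ∑ n ∈ Finset.range (d + 1), |c n|)
          = 1 / 2 := by field_simp
      rw [this]
      norm_num
    rw [h1] at h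
    refine h.congr_fun fun m => ?_
    simp [coherenceState, Matrix.sum_apply]

theorem superposition_eq_zero (k : Fin s) {n : ℕ} (t : ℝ) {m : PathModes s → ℕ}
    (h : n + 1 < ∑ l, m l) : superposition k n t m = 0 := by
  rw [superposition]
  split_ifs with h1 h2 h3
  · rw [sum_pathModes, h2, Finset.sum_congr rfl fun l _ => congrFun h1 l] at h
    simp at h
  · rw [sum_pathModes, h3, Finset.sum_congr rfl fun l _ => congrFun h1 l] at h
    simp at h
    omega
  · rfl
  · rfl

theorem atMostPhotons_coherenceState (k : Fin s) (d : ℕ) (c : ℕ → ℝ) :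
    AtMostPhotons (d + 1) (coherenceState k d c) := by
  intro m m' h
  simp only [coherenceState, Matrix.sum_apply, Matrix.smul_apply, Matrix.of_apply]
  refine Finset.sum_eq_zero fun n hn => ?_
  have hn' := Finset.mem_range.mp hn
  rcases h with h | h
  · rw [superposition_eq_zero k _ (by omega)]; simp
  · rw [superposition_eq_zero k _ (m := m') (by omega)]; simp

theorem superposition_elim (k : Fin s) (a : ℕ) (t : ℝ) (i : ℕ) (r : Fin s → ℕ) :
    superposition k a t (Sum.elim (fun _ => i) r) = if r = Pi.single k a then
      (if i = 0 then 1 else if i = 1 then (t : ℂ) else 0) else 0 :=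
  rfl

theorem conditional_coherenceState (k : Fin s) (d : ℕ) (c : ℕ → ℝ) (n i j : ℕ) :
    conditional (coherenceState k d c) n i j = if n ≤ d then
      (((|c n| / (2 * ∑ n ∈ Finset.range (d + 1), |c n|) : ℝ)) : ℂ) *
        ((if i = 0 then 1 else if i = 1 then (unitSign (c n) : ℂ) else 0) *
          (if j = 0 then 1 else if j = 1 then (unitSign (c n) : ℂ) else 0)) else 0 := by
  simp only [conditional, coherenceState, Matrix.sum_apply, Matrix.smul_apply, Matrix.of_apply,
    superposition_elim, smul_eq_mul]
  rw [Finset.sum_comm]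
  have hmem : ∀ a, (Pi.single k a : Fin s → ℕ) ∈ Finset.piAntidiag Finset.univ n ↔ a = n := by
    intro a
    rw [Finset.mem_piAntidiag]
    simp
  simp only [apply_ite star, star_zero, star_one, Complex.star_def, Complex.conj_ofReal, ite_mul,
    zero_mul, mul_ite, mul_zero, Finset.sum_ite_eq', hmem]
  simp only [Finset.mem_range, Nat.lt_succ_iff]
  split_ifs <;> simp

theorem weightedConditional_coherenceState (k : Fin s) (d : ℕ) {c : ℕ → ℝ} {u : ℝ}
    (hu : ∑ n ∈ Finset.range (d + 1), c n * (u ^ 2) ^ n = 0) :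
    weightedConditional u (d + 1) (coherenceState k d c)
      = weightedConditional u (d + 1) (coherenceState k d (-c)) := by
  -- the coherence `(0, 1)` of the weighted operator vanishes, for `c` and for `-c`
  have hcoh : ∀ c' : ℕ → ℝ, ∑ n ∈ Finset.range (d + 1), c' n * (u ^ 2) ^ n = 0 →
      ∑ n ∈ Finset.range (d + 1 + 1), ((u : ℂ) ^ 2) ^ n * (if n ≤ d then
        (((|c' n| / (2 * ∑ n ∈ Finset.range (d + 1), |c' n|) : ℝ)) : ℂ) * (unitSign (c' n) : ℂ)
        else 0) = 0 := by
    intro c' hc'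
    rw [Finset.sum_range_succ, if_neg (by omega), mul_zero, add_zero]
    have : ∀ n ∈ Finset.range (d + 1), ((u : ℂ) ^ 2) ^ n * (if n ≤ d then
        (((|c' n| / (2 * ∑ n ∈ Finset.range (d + 1), |c' n|) : ℝ)) : ℂ) * (unitSign (c' n) : ℂ)
        else 0) = ((c' n * (u ^ 2) ^ n : ℝ) : ℂ) *
          (((2 * ∑ n ∈ Finset.range (d + 1), |c' n|)⁻¹ : ℝ) : ℂ) := by
      intro n hn
      rw [if_pos (Nat.lt_succ_iff.mp (Finset.mem_range.mp hn)), ← Complex.ofReal_mul,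
        div_mul_eq_mul_div, abs_mul_unitSign, div_eq_mul_inv]
      push_cast
      ring
    rw [Finset.sum_congr rfl this, ← Finset.sum_mul, ← Complex.ofReal_sum, hc']
    simp
  have h1 := hcoh c hu
  have h2 := hcoh (-c) (by simpa using hu)
  have hsq : ∀ x : ℝ, (unitSign x : ℂ) * (unitSign x : ℂ) = 1 := fun x => by
    rw [← Complex.ofReal_mul, unitSign_mul_self, Complex.ofReal_one]
  ext i j
  simp only [weightedConditional, conditional_coherenceState]
  simp only [Pi.neg_apply, abs_neg] at h2 ⊢
  by_cases hi0 : i = 0 <;> by_cases hi1 : i = 1 <;> by_cases hj0 : j = 0 <;>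
    by_cases hj1 : j = 1 <;> first
    | omega
    | (simp only [hi0, hi1, hj0, hj1, if_true, if_false, one_ne_zero, one_mul, mul_one, mul_zero,
        zero_mul, hsq]
       try rw [h1, h2])

/-- If two weights are roots of a polynomial of degree `d`, its coefficients are the coherences of
an undetectable perturbation with `d + 1` photons. -/
theorem not_clickStatisticsDetermine (hs : 1 ≤ s) {η ζ : ℝ} (h : η ^ 2 + ζ ^ 2 = 1) (d : ℕ)
    {c : ℕ → ℝ} (hc : c d ≠ 0) (hcη : ∑ n ∈ Finset.range (d + 1), c n * (η ^ 2) ^ n = 0)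
    (hcζ : ∑ n ∈ Finset.range (d + 1), c n * (ζ ^ 2) ^ n = 0) :
    ¬ ClickStatisticsDetermine s η ζ (d + 1) := by
  intro hdet
  let k : Fin s := ⟨0, hs⟩
  have hρ := isState_coherenceState k d hc
  have hσ := isState_coherenceState k d (c := -c) (by simpa using hc)
  have hNρ := atMostPhotons_coherenceState k d c
  have hNσ := atMostPhotons_coherenceState k d (-c)
  have h00 : coherenceState k d c 0 0 = coherenceState k d (-c) 0 0 := by
    rw [← conditional_zero_zero_zero (coherenceState k d c),
      ← conditional_zero_zero_zero (coherenceState k d (-c)), conditional_coherenceState,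
      conditional_coherenceState]
    simp
  have heq := hdet _ _ hρ hσ hNρ hNσ (clickProb_eq_of_weightedConditional_eq hρ hσ hNρ hNσ h
    (weightedConditional_coherenceState k d hcζ) (weightedConditional_coherenceState k d hcη) h00)
  have hd := congrFun (congrFun heq (0, d)) (1, d)
  rw [twirledTwoMode_apply, twirledTwoMode_apply, conditional_coherenceState,
    conditional_coherenceState] at hd
  have hW : 0 < ∑ n ∈ Finset.range (d + 1), |c n| :=
    Finset.sum_pos' (fun n _ => abs_nonneg _) ⟨d, by simp, abs_pos.mpr hc⟩
  simp only [le_refl, if_true, one_ne_zero, if_false, one_mul, ← Complex.ofReal_mul,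
    Complex.ofReal_inj, div_mul_eq_mul_div, abs_mul_unitSign, Pi.neg_apply, abs_neg] at hd
  have h3 : |c d| * unitSign (-c d) = - c d := by
    rw [← abs_neg]; exact abs_mul_unitSign _
  rw [h3] at hd
  field_simp at hd
  exact hc (by linarith)

end Counterexample

/-! ### Balanced and unbalanced beam splitters -/

theorem isBalanced_iff {η ζ : ℝ} (h : η ^ 2 + ζ ^ 2 = 1) : IsBalanced η ζ ↔ η ^ 2 = ζ ^ 2 := by
  have hsq : (1 / √2 : ℝ) ^ 2 = 1 / 2 := by
    rw [div_pow, Real.sq_sqrt (by norm_num)]; norm_num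
  constructor
  · rintro ⟨h1, h2⟩
    rw [← sq_abs η, ← sq_abs ζ, h1, h2]
  · intro heq
    have h0 : (0 : ℝ) ≤ 1 / √2 := by positivity
    constructor
    · rw [← abs_of_nonneg h0, ← sq_eq_sq_iff_abs_eq_abs, hsq]; linarith
    · rw [← abs_of_nonneg h0, ← sq_eq_sq_iff_abs_eq_abs, hsq]; linarith

end WFH

end

theorem mainTheorem11 (s : ℕ) (hs : 1 ≤ s) (η ζ : ℝ) (hηζ : η ^ 2 + ζ ^ 2 = 1)
    (hη : η ≠ 0) (hζ : ζ ≠ 0) (N : ℕ) :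
    (¬ WFH.IsBalanced η ζ → (WFH.ClickStatisticsDetermine s η ζ N ↔ N ≤ 2)) ∧
    (WFH.IsBalanced η ζ → (WFH.ClickStatisticsDetermine s η ζ N ↔ N ≤ 1)) := by
  rw [WFH.isBalanced_iff hηζ]
  refine ⟨fun hne => ⟨fun hdet => ?_, fun hN =>
    (WFH.clickStatisticsDetermine_two hηζ hη hζ hne).mono hN⟩, fun heq => ⟨fun hdet => ?_,
    fun hN => (WFH.clickStatisticsDetermine_one hηζ hη hζ).mono hN⟩⟩
  · by_contra hN
    -- the polynomial `(X - η ^ 2) * (X - ζ ^ 2)`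
    refine WFH.not_clickStatisticsDetermine hs hηζ 2
      (c := fun n => if n = 0 then η ^ 2 * ζ ^ 2 else if n = 1 then -1 else 1) (by simp) ?_ ?_
      (hdet.mono (by omega))
    · simp [Finset.sum_range_succ]
      linear_combination η ^ 2 * hηζ
    · simp [Finset.sum_range_succ]
      linear_combination ζ ^ 2 * hηζ
  · by_contra hN
    -- the polynomial `X - 1 / 2`
    refine WFH.not_clickStatisticsDetermine hs hηζ 1
      (c := fun n => if n = 0 then -(1 / 2) else 1) (by simp) ?_ ?_ (hdet.mono (by omega))
    · simp [Finset.sum_range_succ]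
      linarith
    · simp [Finset.sum_range_succ]
      linarith
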